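/- Let $0<m<M$ be integers and let $\varepsilon_l,\rho_l,\alpha_l$ ($1\le l\le M$) be real numbers (those $\rho_l,\alpha_l$ with $l\le m$ do not occur below). Consider the vector Hirota equation for complex-valued $u_1,\dots,u_M$ of $(x,t)\in\mathbb R^2$: $$u_{k,t}=u_{k,xxx}-3\Big(\sum_{l=1}^M\varepsilon_l|u_l|^2\Big)u_{k,x}-3u_k\sum_{l=1}^M\varepsilon_l u_l^*u_{l,x},\qquad k=1,\dots,M. \tag{H}$$ Write $S=\sum_{l=m+1}^M\varepsilon_l\rho_l^2$, $A=\sum_{l=m+1}^M\varepsilon_l\alpha_l\rho_l^2$, and let $D_x,D_t$ be Hirota's operators, $D_x^nF\cdot G=(\partial_x-\partial_{x'})^nF(x,t)G(x',t)|_{x'=x}$, $D_tF\cdot G=F_tG-FG_t$. **(a) Bilinearization.** Let $\Omega\subseteq\mathbb R^2$ be open, let $f,g_k,h_l$ ($k\le m<l\le M$) be $C^3$ functions on $\Omega$ with $f$ real-valued and nowhere zero, and put $$u_k=\frac{g_k}{f}e^{-3\mathrm iAt}\quad(k\le m),\qquad u_l=\rho_l\frac{h_l}{f}e^{\mathrm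 i(\alpha_lx-(\alpha_l^3+3A+3\alpha_lS)t)}\quad(l>m).$$ Consider the bilinear system, with auxiliary functions $s_{ki}=-s_{ik}$ ($k,i\le m$) and $r_{li}=r_{il}$ ($l>m$, $1\le i\le M$), where $k\le m<l\le M$: $$[D_x^3-D_t-6SD_x+3\mathrm iA]\,g_k\cdot f=-3\sum_{i=1}^m\varepsilon_ig_i^*s_{ki}+3\mathrm i\sum_{i=m+1}^M\varepsilon_i\alpha_i\rho_i^2h_i^*r_{ki},\tag{1}$$ $$[D_x^3-D_t+3\mathrm i\alpha_lD_x^2-3(\alpha_l^2+2S)D_x-3\mathrm i\alpha_lS+3\mathrm iA]\,h_l\cdot f=-3\mathrm i\alpha_l\sum_{i=1}^m\varepsilon_ig_i^*r_{li}-3\mathrm i\sum_{i=m+1}^M\varepsilon_i(\alpha_l-\alpha_i)\rho_i^2h_i^*r_{li},\tag{2}$$ $$(D_x^2-2S)f\cdot f+2\sum_{k=1}^m\varepsilon_k|g_k|^2+2\sum_{l=m+1}^M\varepsilon_l\rho_l^2|h_l|^2=0,\tag{3}$$ $$D_xg_k\cdot g_i=s_{ki}f\quad(i\le m),\tag{4}$$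 $$(D_x-\mathrm i\alpha_i)g_k\cdot h_i=-\mathrm i\alpha_ir_{ki}f\quad(i>m),\tag{5}$$ $$[D_x+\mathrm i(\alpha_l-\alpha_i)]h_l\cdot h_i=\mathrm i(\alpha_l-\alpha_i)r_{li}f\quad(i>m).\tag{6}$$ Suppose (3)–(6) and the stated symmetries of $s,r$ hold on $\Omega$. If (1) and (2) hold on $\Omega$, then $u=(u_1,\dots,u_M)$ is a solution of (H) on $\Omega$. Conversely, if $\rho_l\ne0$ for all $l>m$ and $u$ is a solution of (H) on $\Omega$, then (1) and (2) hold on $\Omega$. **(b) Soliton solutions.** Let $N\ge0$ and let $p_i,\xi_{i0},C_i^{(k)}\in\mathbb C$ ($1\le i\le N$, $1\le k\le m$) be such that, for all $i,j$, $p_i+p_j^*\neq0$ and $$G_{ij}:=\sum_{l=m+1}^M\frac{\varepsilon_l\rho_l^2}{(p_i-\mathrm i\alpha_l)(p_j^*+\mathrm i\alpha_l)}-1\neq0 .$$ Let $\xi_i=p_i(x-3St)+p_i^3t+\xi_{i0}$, and for an integer vector $\mathbf n=(k_{m+1},\dots,k_M)$ let $M_{\mathbf n}$ be the $N\times N$ matrix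 $$(M_{\mathbf n})_{ij}=\frac{1}{p_i+p_j^*}e^{\xi_i+\xi_j^*}\prod_{n=m+1}^M\Big(-\frac{p_i-\mathrm i\alpha_n}{p_j^*+\mathrm i\alpha_n}\Big)^{k_n}+\frac{\sum_{l=1}^m\varepsilon_l(C_i^{(l)})^*C_j^{(l)}}{(p_i+p_j^*)\,G_{ij}} .$$ Put, with $\Phi=(e^{\xi_1},\dots,e^{\xi_N})^T$, $\bar\Psi^{(k)}=(C_1^{(k)},\dots,C_N^{(k)})^T$ and $\mathbf e_l$ the standard unit vectors, $$f=|M_{\mathbf 0}|,\qquad g_k=\begin{vmatrix}M_{\mathbf 0}&\Phi\\-(\bar\Psi^{(k)})^T&0\end{vmatrix}\ (k\le m),\qquad h_l=|M_{\mathbf e_l}|\ (l>m).$$ On the open set $\Omega=\{(x,t):f(x,t)\neq0\}$ the function $f$ is real-valued, and the $u_1,\dots,u_M$ obtained from $f,g_k,h_l$ by the transformation in (a) are $C^3$ and solve (H). If moreover $\alpha_l\ne0$ for all $l>m$, then there are functions $s_{ki},r_{li}$ with the stated symmetries such that $f,g_k,h_l,s_{ki},r_{li}$ satisfy the whole bilinear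 system (1)–(6) on $\Omega$. -/

import Mathlib

open scoped ComplexConjugate

namespace VectorHirota

/-- `F` is `C^n` on the set `Ω` of the `(x, t)`-plane. -/
def SmoothOn (n : ℕ) (F : ℝ → ℝ → ℂ) (Ω : Set (ℝ × ℝ)) : Prop :=
  ContDiffOn ℝ n (fun q : ℝ × ℝ => F q.1 q.2) Ω

/-- The `n`-th partial derivative in `x`. -/
noncomputable def dx (n : ℕ) (F : ℝ → ℝ → ℂ) (x t : ℝ) : ℂ :=
  iteratedDeriv n (fun y => F y t) x

/-- The partial derivative in `t`. -/
noncomputable def dt (F : ℝ → ℝ → ℂ) (x t : ℝ) : ℂ :=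
  deriv (fun y => F x y) t

/-- Hirota's operator `D_x^n F · G = (∂_x - ∂_x')^n F(x, t) G(x', t)` at `x' = x`,
expanded by the binomial theorem. -/
noncomputable def Dx (n : ℕ) (F G : ℝ → ℝ → ℂ) (x t : ℝ) : ℂ :=
  ∑ j ∈ Finset.range (n + 1),
    (-1 : ℂ) ^ (n - j) * (n.choose j : ℂ) * dx j F x t * dx (n - j) G x t

/-- Hirota's operator `D_t F · G = F_t G - F G_t`. -/
noncomputable def Dt (F G : ℝ → ℝ → ℂ) (x t : ℝ) : ℂ :=
  dt F x t * G x t - F x t * dt G x t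

/-- `u` is a (classical) solution on the open set `Ω` of the vector Hirota equation
`u_{k,t} = u_{k,xxx} - 3 (∑ ε_l |u_l|²) u_{k,x} - 3 u_k ∑ ε_l u_l^* u_{l,x}`. -/
structure IsSolutionOn {M : ℕ} (ε : Fin M → ℝ) (Ω : Set (ℝ × ℝ))
    (u : Fin M → ℝ → ℝ → ℂ) : Prop where
  isOpen : IsOpen Ω
  smooth : ∀ k, SmoothOn 3 (u k) Ω
  eqn : ∀ k x t, (x, t) ∈ Ω →
    dt (u k) x t = dx 3 (u k) x t
      - 3 * (∑ l, (ε l : ℂ) * (‖u l x t‖ : ℂ) ^ 2) * dx 1 (u k) x t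
      - 3 * u k x t * ∑ l, (ε l : ℂ) * conj (u l x t) * dx 1 (u l) x t

/-- Indices of the bright components: the first `m` ones. -/
def bright (M m : ℕ) : Finset (Fin M) := Finset.univ.filter fun i => i.val < m

/-- Indices of the dark components: all but the first `m` ones. -/
def dark (M m : ℕ) : Finset (Fin M) := Finset.univ.filter fun i => m ≤ i.val

/-- `∑ ε_l ρ_l²` over the dark components. -/
noncomputable def S {M : ℕ} (m : ℕ) (ε ρ : Fin M → ℝ) : ℝ :=
  ∑ l ∈ dark M m, ε l * ρ l ^ 2

/-- `∑ ε_l α_l ρ_l²` over the dark components. -/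
noncomputable def A {M : ℕ} (m : ℕ) (ε ρ α : Fin M → ℝ) : ℝ :=
  ∑ l ∈ dark M m, ε l * α l * ρ l ^ 2

/-- The gauge transformation. Bright components: `u_k = (g_k / f) exp(-3 i A t)`. Dark components:
`u_l = ρ_l (h_l / f) exp(i (α_l x - (α_l³ + 3 A + 3 α_l S) t))`. -/
noncomputable def field {M : ℕ} (m : ℕ) (ε ρ α : Fin M → ℝ) (f : ℝ → ℝ → ℂ)
    (g h : Fin M → ℝ → ℝ → ℂ) (k : Fin M) (x t : ℝ) : ℂ :=
  if k.val < m then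
    g k x t / f x t * Complex.exp (-3 * Complex.I * (A m ε ρ α : ℂ) * t)
  else
    (ρ k : ℂ) * (h k x t / f x t) *
      Complex.exp (Complex.I *
        ((α k * x - (α k ^ 3 + 3 * A m ε ρ α + 3 * α k * S m ε ρ) * t : ℝ) : ℂ))

/-- The functions `f`, `g_k` (bright `k`), `h_l` (dark `l`) are admissible in the gauge
transformation on `Ω`: sufficiently smooth, and `f` is real and has no zeros. -/
structure AdmissibleOn {M : ℕ} (m : ℕ) (Ω : Set (ℝ × ℝ)) (f : ℝ → ℝ → ℂ)
    (g h : Fin M → ℝ → ℝ → ℂ) : Prop where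
  isOpen : IsOpen Ω
  smooth_f : SmoothOn 3 f Ω
  smooth_g : ∀ k ∈ bright M m, SmoothOn 3 (g k) Ω
  smooth_h : ∀ l ∈ dark M m, SmoothOn 3 (h l) Ω
  real_f : ∀ x t, (x, t) ∈ Ω → conj (f x t) = f x t
  ne_zero_f : ∀ x t, (x, t) ∈ Ω → f x t ≠ 0

/-- The bilinear equations that contain no `t`-derivative: the quadratic relation between
`f`, `g_k`, `h_l`, and the equations through which the auxiliary functions `s_{ki}`
(`k`, `i` bright) and `r_{ki}` (at least one index dark) are introduced. -/
structure AuxiliaryOn {M : ℕ} (m : ℕ) (ε ρ α : Fin M → ℝ) (Ω : Set (ℝ × ℝ)) (f : ℝ → ℝ → ℂ)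
    (g h : Fin M → ℝ → ℝ → ℂ) (s r : Fin M → Fin M → ℝ → ℝ → ℂ) : Prop where
  quadratic : ∀ x t, (x, t) ∈ Ω →
    Dx 2 f f x t - 2 * (S m ε ρ : ℂ) * (f x t * f x t)
      + 2 * (∑ k ∈ bright M m, (ε k : ℂ) * (‖g k x t‖ : ℂ) ^ 2)
      + 2 * (∑ l ∈ dark M m, (ε l : ℂ) * (ρ l : ℂ) ^ 2 * (‖h l x t‖ : ℂ) ^ 2) = 0
  bright_bright : ∀ k ∈ bright M m, ∀ i ∈ bright M m, ∀ x t, (x, t) ∈ Ω →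
    Dx 1 (g k) (g i) x t = s k i x t * f x t
  bright_dark : ∀ k ∈ bright M m, ∀ i ∈ dark M m, ∀ x t, (x, t) ∈ Ω →
    Dx 1 (g k) (h i) x t - Complex.I * (α i : ℂ) * (g k x t * h i x t)
      = -Complex.I * (α i : ℂ) * r k i x t * f x t
  dark_dark : ∀ l ∈ dark M m, ∀ i ∈ dark M m, ∀ x t, (x, t) ∈ Ω →
    Dx 1 (h l) (h i) x t + Complex.I * ((α l : ℂ) - (α i : ℂ)) * (h l x t * h i x t)
      = Complex.I * ((α l : ℂ) - (α i : ℂ)) * r l i x t * f x t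
  s_antisymm : ∀ k ∈ bright M m, ∀ i ∈ bright M m, ∀ x t, (x, t) ∈ Ω →
    s k i x t = -s i k x t
  r_symm : ∀ l ∈ dark M m, ∀ i, ∀ x t, (x, t) ∈ Ω → r l i x t = r i l x t

/-- The bilinear evolution equations for the bright `g_k` and for the dark `h_l`. -/
structure EvolutionOn {M : ℕ} (m : ℕ) (ε ρ α : Fin M → ℝ) (Ω : Set (ℝ × ℝ)) (f : ℝ → ℝ → ℂ)
    (g h : Fin M → ℝ → ℝ → ℂ) (s r : Fin M → Fin M → ℝ → ℝ → ℂ) : Prop where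
  bright : ∀ k ∈ bright M m, ∀ x t, (x, t) ∈ Ω →
    Dx 3 (g k) f x t - Dt (g k) f x t - 6 * (S m ε ρ : ℂ) * Dx 1 (g k) f x t
        + 3 * Complex.I * (A m ε ρ α : ℂ) * (g k x t * f x t)
      = -3 * (∑ i ∈ bright M m, (ε i : ℂ) * conj (g i x t) * s k i x t)
        + 3 * Complex.I *
          ∑ i ∈ dark M m, (ε i : ℂ) * (α i : ℂ) * (ρ i : ℂ) ^ 2 * conj (h i x t) * r k i x t
  dark : ∀ l ∈ dark M m, ∀ x t, (x, t) ∈ Ω →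
    Dx 3 (h l) f x t - Dt (h l) f x t + 3 * Complex.I * (α l : ℂ) * Dx 2 (h l) f x t
        - 3 * ((α l : ℂ) ^ 2 + 2 * (S m ε ρ : ℂ)) * Dx 1 (h l) f x t
        + (-3 * Complex.I * (α l : ℂ) * (S m ε ρ : ℂ) + 3 * Complex.I * (A m ε ρ α : ℂ))
          * (h l x t * f x t)
      = -3 * Complex.I *
          (∑ i ∈ VectorHirota.bright M m, (ε i : ℂ) * (α l : ℂ) * conj (g i x t) * r l i x t)
        - 3 * Complex.I *
          ∑ i ∈ dark M m, (ε i : ℂ) * ((α l : ℂ) - (α i : ℂ)) * (ρ i : ℂ) ^ 2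
            * conj (h i x t) * r l i x t

/-- `∑ ε_l ρ_l² / ((p_i - i α_l) (p_j^* + i α_l)) - 1`, summed over the dark components. -/
noncomputable def gram {M N : ℕ} (m : ℕ) (ε ρ α : Fin M → ℝ) (p : Fin N → ℂ) (i j : Fin N) : ℂ :=
  (∑ l ∈ dark M m, (ε l : ℂ) * (ρ l : ℂ) ^ 2 /
    ((p i - Complex.I * (α l : ℂ)) * (conj (p j) + Complex.I * (α l : ℂ)))) - 1

/-- The phase `ξ_i = p_i (x - 3 S t) + p_i³ t + ξ_{i0}`. -/
noncomputable def phase {M N : ℕ} (m : ℕ) (ε ρ : Fin M → ℝ) (p ξ₀ : Fin N → ℂ) (i : Fin N)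
    (x t : ℝ) : ℂ :=
  p i * ((x : ℂ) - 3 * (S m ε ρ : ℂ) * t) + p i ^ 3 * t + ξ₀ i

/-- The `N × N` matrix `M_n` for an integer vector `n = (k_1, …, k_M)`, of which only the entries
at the dark components enter. -/
noncomputable def mat {M N : ℕ} (m : ℕ) (ε ρ α : Fin M → ℝ) (p ξ₀ : Fin N → ℂ)
    (C : Fin M → Fin N → ℂ) (n : Fin M → ℤ) (x t : ℝ) : Matrix (Fin N) (Fin N) ℂ :=
  Matrix.of fun i j =>
    1 / (p i + conj (p j))
        * Complex.exp (phase m ε ρ p ξ₀ i x t + conj (phase m ε ρ p ξ₀ j x t))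
        * ∏ a ∈ dark M m,
          (-((p i - Complex.I * (α a : ℂ)) / (conj (p j) + Complex.I * (α a : ℂ)))) ^ n a
      + (∑ l ∈ bright M m, (ε l : ℂ) * conj (C l i) * C l j)
        / ((p i + conj (p j)) * gram m ε ρ α p i j)

/-- `f = |M_0|`. -/
noncomputable def tauF {M N : ℕ} (m : ℕ) (ε ρ α : Fin M → ℝ) (p ξ₀ : Fin N → ℂ)
    (C : Fin M → Fin N → ℂ) (x t : ℝ) : ℂ :=
  (mat m ε ρ α p ξ₀ C 0 x t).det

/-- `g_k`: the determinant of `M_0` bordered by the column `Φ = (e^{ξ_i})`, the row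
`-(C_1^{(k)}, …, C_N^{(k)})` and the corner `0`. -/
noncomputable def tauG {M N : ℕ} (m : ℕ) (ε ρ α : Fin M → ℝ) (p ξ₀ : Fin N → ℂ)
    (C : Fin M → Fin N → ℂ) (k : Fin M) (x t : ℝ) : ℂ :=
  (Matrix.fromBlocks (mat m ε ρ α p ξ₀ C 0 x t)
    (Matrix.of fun (i : Fin N) (_ : Unit) => Complex.exp (phase m ε ρ p ξ₀ i x t))
    (Matrix.of fun (_ : Unit) (j : Fin N) => -C k j)
    0).det

/-- `h_l = |M_{e_l}|`. -/
noncomputable def tauH {M N : ℕ} (m : ℕ) (ε ρ α : Fin M → ℝ) (p ξ₀ : Fin N → ℂ)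
    (C : Fin M → Fin N → ℂ) (l : Fin M) (x t : ℝ) : ℂ :=
  (mat m ε ρ α p ξ₀ C (Pi.single l 1) x t).det

end VectorHirota

namespace VectorHirota

/-! ### Slices of smooth functions -/

section Slices

variable {F G : ℝ → ℝ → ℂ} {Ω : Set (ℝ × ℝ)} {n : ℕ} {x t : ℝ}

/-! Both parts reduce to one pointwise statement, `EnvelopeEq`: the equation left for the quotients
w_k = g_k/f, h_l/f after the carrier waves have been removed. The carriers have modulus one, so they
drop out of the density ∑ ε|u|² and enter the current ∑ ε u^* u_x only through i·(wave number).
Equation (H) for one component is then amplitude × carrier × envelope equation (`isSolutionOn_iff`).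
A vanishing amplitude ρ_l is therefore the only obstacle to the converse in (a).

For (a), put F = a f. Then D_x^3 F·f = f² a_xxx + 3 a_x D_x^2 f·f, and similarly in lower order,
while (3) says D_x^2 f·f = 2 f² (S - density). By (4)–(6) the right-hand sides of (1) and (2) are
sums of Wronskians weighted by w_i^*, and these equal density · w' - w · current (`sum_wronskian`).
So each evolution equation is f² times the envelope equation (`evolutionOn_iff`).

For (b), let P = diag(p_i) and M = M_0. Then P M + M P^* = ΦΦ^† + B with B constant, so M_x = ΦΦ^†
has rank one and M_t is a combination of a few rank-one matrices. The envelopes are linear in z_0 =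
M⁻¹Φ: a Schur complement gives g_k/f, and the matrix determinant lemma gives h_l/f. The vectors z_n
= M⁻¹P^nΦ have closed derivative rules, so both kinds of envelope satisfy one linear third-order
equation whose potentials are built from the scalars Φ^†(P^*)^a z_n (`linear_problem`).

It remains to identify the potentials with density and current. The definition of G_ij says B_ij
G_ij = ∑ ε_l (C_i^{(l)})^* C_j^{(l)}. Sandwiching this between z_0^† and z_n gives
`sum_bright_pairing`; n = 0 yields the density and n = 1 the current. -/

theorem SmoothOn.contDiffAt (hF : SmoothOn n F Ω) (hΩ : IsOpen Ω) (h : (x, t) ∈ Ω) :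
    ContDiffAt ℝ n (fun q : ℝ × ℝ => F q.1 q.2) (x, t) :=
  ContDiffOn.contDiffAt hF (hΩ.mem_nhds h)

theorem SmoothOn.contDiffAt_fst (hF : SmoothOn n F Ω) (hΩ : IsOpen Ω) (h : (x, t) ∈ Ω) :
    ContDiffAt ℝ n (fun y => F y t) x :=
  (hF.contDiffAt hΩ h).comp x (f := fun y : ℝ => (y, t)) (by fun_prop)

theorem SmoothOn.contDiffAt_snd (hF : SmoothOn n F Ω) (hΩ : IsOpen Ω) (h : (x, t) ∈ Ω) :
    ContDiffAt ℝ n (fun y => F x y) t :=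
  (hF.contDiffAt hΩ h).comp t (f := fun y : ℝ => (x, y)) (by fun_prop)

theorem SmoothOn.differentiableAt_snd (hF : SmoothOn 3 F Ω) (hΩ : IsOpen Ω) (h : (x, t) ∈ Ω) :
    DifferentiableAt ℝ (fun y => F x y) t :=
  (hF.contDiffAt_snd hΩ h).differentiableAt (by norm_num)

theorem SmoothOn.div (hF : SmoothOn n F Ω) (hG : SmoothOn n G Ω)
    (h0 : ∀ x t, (x, t) ∈ Ω → G x t ≠ 0) :
    SmoothOn n (fun x t => F x t / G x t) Ω := by
  have h : ContDiffOn ℝ n (fun q : ℝ × ℝ => (G q.1 q.2)⁻¹) Ω :=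
    ContDiffOn.inv hG fun q hq => h0 q.1 q.2 hq
  simpa only [SmoothOn, div_eq_mul_inv] using ContDiffOn.mul hF h

theorem eventually_fst (hΩ : IsOpen Ω) (h : (x, t) ∈ Ω) : ∀ᶠ y in nhds x, (y, t) ∈ Ω :=
  (Continuous.prodMk_left t).continuousAt.eventually_mem (hΩ.mem_nhds h)

theorem eventually_snd (hΩ : IsOpen Ω) (h : (x, t) ∈ Ω) : ∀ᶠ y in nhds t, (x, y) ∈ Ω :=
  (Continuous.prodMk_right x).continuousAt.eventually_mem (hΩ.mem_nhds h)

theorem dx_congr (hΩ : IsOpen Ω) (h : (x, t) ∈ Ω)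
    (hFG : ∀ x t, (x, t) ∈ Ω → F x t = G x t) (k : ℕ) : dx k F x t = dx k G x t := by
  apply Filter.EventuallyEq.iteratedDeriv_eq
  filter_upwards [eventually_fst hΩ h] with y hy using hFG y t hy

theorem dt_congr (hΩ : IsOpen Ω) (h : (x, t) ∈ Ω)
    (hFG : ∀ x t, (x, t) ∈ Ω → F x t = G x t) : dt F x t = dt G x t := by
  apply Filter.EventuallyEq.deriv_eq
  filter_upwards [eventually_snd hΩ h] with y hy using hFG x y hy

@[simp] theorem dx_zero : dx 0 F x t = F x t := by simp [dx]

/-- Leibniz' rule in `x`. -/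
theorem dx_mul (hΩ : IsOpen Ω) (h : (x, t) ∈ Ω) (hF : SmoothOn n F Ω) (hG : SmoothOn n G Ω)
    {k : ℕ} (hk : k ≤ n) :
    dx k (fun x t => F x t * G x t) x t
      = ∑ i ∈ Finset.range (k + 1), (k.choose i : ℂ) * dx i F x t * dx (k - i) G x t := by
  have hk' : (k : WithTop ℕ∞) ≤ n := by exact_mod_cast hk
  exact iteratedDeriv_fun_mul ((hF.contDiffAt_fst hΩ h).of_le hk')
    ((hG.contDiffAt_fst hΩ h).of_le hk')

/-- Leibniz' rule in `t`. -/
theorem dt_mul (hΩ : IsOpen Ω) (h : (x, t) ∈ Ω) (hF : SmoothOn 3 F Ω) (hG : SmoothOn 3 G Ω) :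
    dt (fun x t => F x t * G x t) x t = dt F x t * G x t + F x t * dt G x t :=
  deriv_fun_mul (hF.differentiableAt_snd hΩ h) (hG.differentiableAt_snd hΩ h)

end Slices

/-! ### Plane waves -/

/-- The plane wave `exp(i (a x + b t))`. -/
noncomputable def planeWave (a b : ℝ) (x t : ℝ) : ℂ :=
  Complex.exp (Complex.I * ((a * x + b * t : ℝ) : ℂ))

theorem planeWave_ne_zero (a b x t : ℝ) : planeWave a b x t ≠ 0 := Complex.exp_ne_zero _

theorem conj_planeWave_mul (a b x t : ℝ) :
    conj (planeWave a b x t) * planeWave a b x t = 1 := by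
  rw [planeWave, ← Complex.exp_conj, ← Complex.exp_add]
  simp

theorem smoothOn_planeWave (n : ℕ) (a b : ℝ) (Ω : Set (ℝ × ℝ)) :
    SmoothOn n (planeWave a b) Ω := by
  have h1 : ContDiff ℝ n fun q : ℝ × ℝ => a * q.1 + b * q.2 := by fun_prop
  have h : ContDiff ℝ n fun q : ℝ × ℝ => ((a * q.1 + b * q.2 : ℝ) : ℂ) :=
    Complex.ofRealCLM.contDiff.comp h1
  exact ((contDiff_const.mul h).cexp).contDiffOn

theorem dx_planeWave (n : ℕ) (a b x t : ℝ) :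
    dx n (planeWave a b) x t = (Complex.I * a) ^ n * planeWave a b x t := by
  induction n generalizing x with
  | zero => simp
  | succ n ih =>
    have h : (iteratedDeriv n fun y => planeWave a b y t)
        = fun y => (Complex.I * a) ^ n * planeWave a b y t := funext ih
    have h1 : HasDerivAt (fun y : ℝ => a * y + b * t) a x := by
      simpa using ((hasDerivAt_id x).const_mul a).add_const (b * t)
    have h2 := ((h1.ofReal_comp).const_mul Complex.I).cexp
    rw [dx, iteratedDeriv_succ, h]
    refine ((h2.const_mul ((Complex.I * a) ^ n)).deriv).trans ?_
    rw [planeWave]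
    ring

theorem dt_planeWave (a b x t : ℝ) :
    dt (planeWave a b) x t = Complex.I * b * planeWave a b x t := by
  have h1 : HasDerivAt (fun y : ℝ => a * x + b * y) b t := by
    simpa using ((hasDerivAt_id t).const_mul b).const_add (a * x)
  refine (((h1.ofReal_comp).const_mul Complex.I).cexp.deriv).trans ?_
  rw [planeWave]
  ring

/-! ### The equation for the envelopes -/

section Envelope

variable {M : ℕ} (m : ℕ) (ε ρ α : Fin M → ℝ)

/-- The quotients `g_k / f` and `h_l / f`. -/
noncomputable def envelope (f : ℝ → ℝ → ℂ) (g h : Fin M → ℝ → ℝ → ℂ) (k : Fin M) (x t : ℝ) : ℂ :=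
  (if k.val < m then g k x t else h k x t) / f x t

/-- The amplitude of the carrier wave of the `k`-th component. -/
def amplitude (k : Fin M) : ℝ := if k.val < m then 1 else ρ k

/-- The wave number of the carrier wave of the `k`-th component. -/
def waveNumber (k : Fin M) : ℝ := if k.val < m then 0 else α k

/-- The frequency of the carrier wave of the `k`-th component. -/
noncomputable def frequency (k : Fin M) : ℝ :=
  -(waveNumber m α k ^ 3 + 3 * A m ε ρ α + 3 * waveNumber m α k * S m ε ρ)

theorem field_eq (f : ℝ → ℝ → ℂ) (g h : Fin M → ℝ → ℝ → ℂ) (k : Fin M) (x t : ℝ) :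
    field m ε ρ α f g h k x t = (amplitude m ρ k : ℂ) *
      (envelope m f g h k x t * planeWave (waveNumber m α k) (frequency m ε ρ α k) x t) := by
  unfold field envelope amplitude planeWave frequency waveNumber
  split_ifs with hk
  · simp only [Complex.ofReal_one, one_mul]
    congr 2
    push_cast
    ring
  · rw [mul_assoc]
    congr 4
    push_cast
    ring

/-- The density `∑ ε_l |u_l|²` in terms of the envelopes. -/
noncomputable def density (w : Fin M → ℝ → ℝ → ℂ) (x t : ℝ) : ℂ :=
  ∑ l, (ε l : ℂ) * (amplitude m ρ l : ℂ) ^ 2 * (conj (w l x t) * w l x t)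

/-- The current `∑ ε_l u_l^* u_{l,x}` in terms of the envelopes. -/
noncomputable def current (w : Fin M → ℝ → ℝ → ℂ) (x t : ℝ) : ℂ :=
  ∑ l, (ε l : ℂ) * (amplitude m ρ l : ℂ) ^ 2 *
    (conj (w l x t) * (dx 1 (w l) x t + Complex.I * (waveNumber m α l : ℂ) * w l x t))

/-- The vector Hirota equation of the `k`-th component in terms of the envelopes, with the carrier
wave cancelled. -/
def EnvelopeEq (w : Fin M → ℝ → ℝ → ℂ) (k : Fin M) (x t : ℝ) : Prop :=
  dt (w k) x t + Complex.I * (frequency m ε ρ α k : ℂ) * w k x t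
    = dx 3 (w k) x t + 3 * Complex.I * (waveNumber m α k : ℂ) * dx 2 (w k) x t
      - 3 * (waveNumber m α k : ℂ) ^ 2 * dx 1 (w k) x t
      - Complex.I * (waveNumber m α k : ℂ) ^ 3 * w k x t
      - 3 * density m ε ρ w x t
        * (dx 1 (w k) x t + Complex.I * (waveNumber m α k : ℂ) * w k x t)
      - 3 * w k x t * current m ε ρ α w x t

/-- The carrier is unimodular and nowhere zero, so amplitude times carrier factors out of (H). A
component of zero amplitude solves (H) trivially, whence the disjunction. -/
theorem isSolutionOn_iff {Ω : Set (ℝ × ℝ)} {u w : Fin M → ℝ → ℝ → ℂ}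
    (hΩ : IsOpen Ω) (hw : ∀ k, SmoothOn 3 (w k) Ω)
    (hu : ∀ k x t, u k x t = (amplitude m ρ k : ℂ) *
      (w k x t * planeWave (waveNumber m α k) (frequency m ε ρ α k) x t)) :
    IsSolutionOn ε Ω u ↔
      ∀ k x t, (x, t) ∈ Ω → amplitude m ρ k = 0 ∨ EnvelopeEq m ε ρ α w k x t := by
  have hwE : ∀ k, SmoothOn 3
      (fun x t => w k x t * planeWave (waveNumber m α k) (frequency m ε ρ α k) x t) Ω :=
    fun k => ContDiffOn.mul (hw k) (smoothOn_planeWave 3 _ _ Ω)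
  have hu' : ∀ k, u k = fun x t => (amplitude m ρ k : ℂ) *
      (w k x t * planeWave (waveNumber m α k) (frequency m ε ρ α k) x t) :=
    fun k => by ext x t; exact hu k x t
  have hsm : ∀ k, SmoothOn 3 (u k) Ω := fun k => by
    rw [hu' k]; exact contDiffOn_const.mul (hwE k)
  have hdx : ∀ k x t, (x, t) ∈ Ω → ∀ n ≤ 3, dx n (u k) x t = (amplitude m ρ k : ℂ) *
      ∑ i ∈ Finset.range (n + 1), (n.choose i : ℂ) * dx i (w k) x t *
        dx (n - i) (planeWave (waveNumber m α k) (frequency m ε ρ α k)) x t := by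
    intro k x t hxt n hn
    rw [← dx_mul hΩ hxt (hw k) (smoothOn_planeWave 3 _ _ Ω) hn, hu' k]
    exact iteratedDeriv_const_mul_field _ _
  have hdt : ∀ k x t, (x, t) ∈ Ω → dt (u k) x t = (amplitude m ρ k : ℂ) *
      (dt (w k) x t * planeWave (waveNumber m α k) (frequency m ε ρ α k) x t + w k x t *
        dt (planeWave (waveNumber m α k) (frequency m ε ρ α k)) x t) := by
    intro k x t hxt
    rw [← dt_mul hΩ hxt (hw k) (smoothOn_planeWave 3 _ _ Ω), hu' k]
    exact deriv_const_mul_field _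
  have hdens : ∀ x t, (∑ l, (ε l : ℂ) * (‖u l x t‖ : ℂ) ^ 2) = density m ε ρ w x t := by
    intro x t
    refine Finset.sum_congr rfl fun l _ => ?_
    rw [← Complex.conj_mul', hu]
    have := conj_planeWave_mul (waveNumber m α l) (frequency m ε ρ α l) x t
    simp only [map_mul, Complex.conj_ofReal]
    linear_combination
      (ε l : ℂ) * (amplitude m ρ l : ℂ) ^ 2 * (conj (w l x t) * w l x t) * this
  have hcur : ∀ x t, (x, t) ∈ Ω →
      (∑ l, (ε l : ℂ) * conj (u l x t) * dx 1 (u l) x t) = current m ε ρ α w x t := by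
    intro x t hxt
    refine Finset.sum_congr rfl fun l _ => ?_
    rw [hdx l x t hxt 1 (by norm_num), hu]
    have := conj_planeWave_mul (waveNumber m α l) (frequency m ε ρ α l) x t
    simp only [map_mul, Complex.conj_ofReal, Finset.sum_range_succ, Finset.sum_range_zero,
      dx_planeWave, Nat.choose, dx_zero]
    push_cast
    linear_combination (ε l : ℂ) * (amplitude m ρ l : ℂ) ^ 2 * (conj (w l x t) *
      (dx 1 (w l) x t + Complex.I * (waveNumber m α l : ℂ) * w l x t)) * this
  have key : ∀ k x t, (x, t) ∈ Ω → ((dt (u k) x t = dx 3 (u k) x t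
      - 3 * (∑ l, (ε l : ℂ) * (‖u l x t‖ : ℂ) ^ 2) * dx 1 (u k) x t
      - 3 * u k x t * ∑ l, (ε l : ℂ) * conj (u l x t) * dx 1 (u l) x t) ↔
      (amplitude m ρ k = 0 ∨ EnvelopeEq m ε ρ α w k x t)) := by
    intro k x t hxt
    rw [hdens, hcur x t hxt, hdt k x t hxt, hdx k x t hxt 3 le_rfl,
      hdx k x t hxt 1 (by norm_num), hu, EnvelopeEq]
    have hE := planeWave_ne_zero (waveNumber m α k) (frequency m ε ρ α k) x t
    simp only [Finset.sum_range_succ, Finset.sum_range_zero,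
      dx_planeWave, dt_planeWave, Nat.choose, dx_zero]
    -- Both sides become vanishing statements: (H) reads (amplitude · envelope defect) · carrier =
    -- 0.
    rw [← Complex.ofReal_eq_zero, ← sub_eq_zero (b := _ - 3 * w k x t * _), ← mul_eq_zero,
      ← sub_eq_zero]
    refine Iff.trans (Eq.congr ?_ rfl) (mul_eq_zero_iff_right hE)
    push_cast
    linear_combination -(amplitude m ρ k : ℂ) *
      planeWave (waveNumber m α k) (frequency m ε ρ α k) x t *
      ((waveNumber m α k : ℂ) ^ 3 * w k x t * Complex.I
        + 3 * (waveNumber m α k : ℂ) ^ 2 * dx 1 (w k) x t) * Complex.I_sq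
  constructor
  · intro h k x t hxt
    exact (key k x t hxt).1 (h.eqn k x t hxt)
  · intro h
    exact ⟨hΩ, hsm, fun k x t hxt => (key k x t hxt).2 (h k x t hxt)⟩

end Envelope

/-! ### Hirota derivatives of multiples of a common function -/

section Bilinear

variable {F G a b f : ℝ → ℝ → ℂ} {Ω : Set (ℝ × ℝ)} {x t : ℝ}

/-- Gauge covariance of Hirota derivatives: a common factor f leaves f² times the Wronskian of the
quotients. -/
theorem Dx_one_mul_mul (hΩ : IsOpen Ω) (h : (x, t) ∈ Ω) (ha : SmoothOn 3 a Ω)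
    (hb : SmoothOn 3 b Ω) (hf : SmoothOn 3 f Ω)
    (hF : ∀ x t, (x, t) ∈ Ω → F x t = a x t * f x t)
    (hG : ∀ x t, (x, t) ∈ Ω → G x t = b x t * f x t) :
    Dx 1 F G x t = f x t ^ 2 * (dx 1 a x t * b x t - a x t * dx 1 b x t) := by
  simp only [Dx, dx_congr hΩ h hF, dx_congr hΩ h hG, Finset.sum_range_succ,
    Finset.sum_range_zero, Nat.choose]
  norm_num
  rw [dx_mul hΩ h ha hf (by norm_num : 1 ≤ 3), dx_mul hΩ h hb hf (by norm_num : 1 ≤ 3)]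
  simp only [Finset.sum_range_succ, Finset.sum_range_zero, Nat.choose]
  norm_num
  ring

theorem Dx_one_mul_self (hΩ : IsOpen Ω) (h : (x, t) ∈ Ω) (ha : SmoothOn 3 a Ω)
    (hf : SmoothOn 3 f Ω) (hF : ∀ x t, (x, t) ∈ Ω → F x t = a x t * f x t) :
    Dx 1 F f x t = f x t ^ 2 * dx 1 a x t := by
  simp only [Dx, dx_congr hΩ h hF, Finset.sum_range_succ, Finset.sum_range_zero, Nat.choose]
  norm_num
  rw [dx_mul hΩ h ha hf (by norm_num : 1 ≤ 3)]
  simp only [Finset.sum_range_succ, Finset.sum_range_zero, Nat.choose]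
  norm_num
  ring

theorem Dx_two_mul_self (hΩ : IsOpen Ω) (h : (x, t) ∈ Ω) (ha : SmoothOn 3 a Ω)
    (hf : SmoothOn 3 f Ω) (hF : ∀ x t, (x, t) ∈ Ω → F x t = a x t * f x t) :
    Dx 2 F f x t = f x t ^ 2 * dx 2 a x t + a x t * Dx 2 f f x t := by
  simp only [Dx, dx_congr hΩ h hF, Finset.sum_range_succ, Finset.sum_range_zero, Nat.choose]
  norm_num
  rw [dx_mul hΩ h ha hf (by norm_num : 1 ≤ 3), dx_mul hΩ h ha hf (by norm_num : 2 ≤ 3)]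
  simp only [Finset.sum_range_succ, Finset.sum_range_zero, Nat.choose]
  norm_num
  ring

/-- Expanding D_x^3 (af)·f by derivatives of a, the terms with D_x f·f and D_x^3 f·f vanish by
antisymmetry; only D_x^2 f·f survives, and (3) controls it. -/
theorem Dx_three_mul_self (hΩ : IsOpen Ω) (h : (x, t) ∈ Ω) (ha : SmoothOn 3 a Ω)
    (hf : SmoothOn 3 f Ω) (hF : ∀ x t, (x, t) ∈ Ω → F x t = a x t * f x t) :
    Dx 3 F f x t = f x t ^ 2 * dx 3 a x t + 3 * dx 1 a x t * Dx 2 f f x t := by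
  simp only [Dx, dx_congr hΩ h hF, Finset.sum_range_succ, Finset.sum_range_zero, Nat.choose]
  norm_num
  rw [dx_mul hΩ h ha hf (by norm_num : 1 ≤ 3), dx_mul hΩ h ha hf (by norm_num : 2 ≤ 3),
    dx_mul hΩ h ha hf (by norm_num : 3 ≤ 3)]
  simp only [Finset.sum_range_succ, Finset.sum_range_zero, Nat.choose]
  norm_num
  ring

theorem Dt_mul_self (hΩ : IsOpen Ω) (h : (x, t) ∈ Ω) (ha : SmoothOn 3 a Ω)
    (hf : SmoothOn 3 f Ω) (hF : ∀ x t, (x, t) ∈ Ω → F x t = a x t * f x t) :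
    Dt F f x t = f x t ^ 2 * dt a x t := by
  rw [Dt, dt_congr hΩ h hF, hF x t h, dt_mul hΩ h ha hf]
  ring

end Bilinear

/-! ### Bilinearization -/

section Bilinearization

variable {M : ℕ} {m : ℕ} {ε ρ α : Fin M → ℝ}

theorem mem_bright {k : Fin M} : k ∈ bright M m ↔ k.val < m := by simp [bright]

theorem mem_dark {k : Fin M} : k ∈ dark M m ↔ ¬ k.val < m := by simp [dark]

theorem sum_bright_add_sum_dark (F : Fin M → ℂ) :
    ∑ k ∈ bright M m, F k + ∑ k ∈ dark M m, F k = ∑ k, F k := by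
  have : dark M m = Finset.univ.filter fun i : Fin M => ¬ i.val < m := by
    ext; simp [dark]
  rw [this, bright, Finset.sum_filter_add_sum_filter_not]

theorem amplitude_bright {k : Fin M} (hk : k ∈ bright M m) : amplitude m ρ k = 1 :=
  if_pos (mem_bright.1 hk)

theorem amplitude_dark {k : Fin M} (hk : k ∈ dark M m) : amplitude m ρ k = ρ k :=
  if_neg (mem_dark.1 hk)

theorem waveNumber_bright {k : Fin M} (hk : k ∈ bright M m) : waveNumber m α k = 0 :=
  if_pos (mem_bright.1 hk)

theorem waveNumber_dark {k : Fin M} (hk : k ∈ dark M m) : waveNumber m α k = α k :=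
  if_neg (mem_dark.1 hk)

variable {Ω : Set (ℝ × ℝ)} {f : ℝ → ℝ → ℂ} {g h : Fin M → ℝ → ℝ → ℂ}
  {s r : Fin M → Fin M → ℝ → ℝ → ℂ}

theorem AdmissibleOn.smoothOn_envelope (had : AdmissibleOn m Ω f g h) (k : Fin M) :
    SmoothOn 3 (envelope m f g h k) Ω := by
  unfold envelope
  by_cases hk : k.val < m
  · simp only [hk, if_true]
    exact (had.smooth_g k (mem_bright.2 hk)).div had.smooth_f had.ne_zero_f
  · simp only [hk, if_false]
    exact (had.smooth_h k (mem_dark.2 hk)).div had.smooth_f had.ne_zero_f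

theorem AdmissibleOn.bright_eq (had : AdmissibleOn m Ω f g h) {k : Fin M} (hk : k ∈ bright M m)
    (x t : ℝ) (hxt : (x, t) ∈ Ω) : g k x t = envelope m f g h k x t * f x t := by
  rw [envelope, if_pos (mem_bright.1 hk), div_mul_cancel₀ _ (had.ne_zero_f x t hxt)]

theorem AdmissibleOn.dark_eq (had : AdmissibleOn m Ω f g h) {k : Fin M} (hk : k ∈ dark M m)
    (x t : ℝ) (hxt : (x, t) ∈ Ω) : h k x t = envelope m f g h k x t * f x t := by
  rw [envelope, if_neg (mem_dark.1 hk), div_mul_cancel₀ _ (had.ne_zero_f x t hxt)]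

/-- The quadratic bilinear relation expresses the density through `f`. -/
theorem quadratic_iff (had : AdmissibleOn m Ω f g h) {x t : ℝ} (hxt : (x, t) ∈ Ω) :
    Dx 2 f f x t - 2 * (S m ε ρ : ℂ) * (f x t * f x t)
      + 2 * (∑ k ∈ bright M m, (ε k : ℂ) * (‖g k x t‖ : ℂ) ^ 2)
      + 2 * (∑ l ∈ dark M m, (ε l : ℂ) * (ρ l : ℂ) ^ 2 * (‖h l x t‖ : ℂ) ^ 2) = 0 ↔
    Dx 2 f f x t
      = 2 * f x t ^ 2 * ((S m ε ρ : ℂ) - density m ε ρ (envelope m f g h) x t) := by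
  have hf := had.real_f x t hxt
  have h1 : (∑ k ∈ bright M m, (ε k : ℂ) * (‖g k x t‖ : ℂ) ^ 2)
      + (∑ l ∈ dark M m, (ε l : ℂ) * (ρ l : ℂ) ^ 2 * (‖h l x t‖ : ℂ) ^ 2)
      = f x t ^ 2 * density m ε ρ (envelope m f g h) x t := by
    rw [density, Finset.mul_sum, ← sum_bright_add_sum_dark (m := m)]
    congr 1
    · refine Finset.sum_congr rfl fun k hk => ?_
      rw [← Complex.conj_mul', had.bright_eq hk x t hxt, map_mul, hf, amplitude_bright hk]
      push_cast
      ring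
    · refine Finset.sum_congr rfl fun k hk => ?_
      rw [← Complex.conj_mul', had.dark_eq hk x t hxt, map_mul, hf, amplitude_dark hk]
      ring
  rw [← sub_eq_zero (b := 2 * f x t ^ 2 * _)]
  refine Eq.congr ?_ rfl
  linear_combination 2 * h1

/-- The product of the density with a derivative minus the product of a function with the current,
written through Wronskians. -/
theorem sum_wronskian (w : Fin M → ℝ → ℝ → ℂ) (x t : ℝ) (a a' : ℂ) :
    ∑ i, (ε i : ℂ) * (amplitude m ρ i : ℂ) ^ 2 * (conj (w i x t) * (a' * w i x t
      - a * (dx 1 (w i) x t + Complex.I * (waveNumber m α i : ℂ) * w i x t)))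
      = density m ε ρ w x t * a' - a * current m ε ρ α w x t := by
  rw [density, current, Finset.sum_mul, Finset.mul_sum, ← Finset.sum_sub_distrib]
  exact Finset.sum_congr rfl fun i _ => by ring

/-- The third-order Hirota derivative produces -6 · density · w_x, twice what (H) contains. The
Wronskian sum on the right trades half of it for the term -3 w · current. -/
theorem bright_evolution_iff (had : AdmissibleOn m Ω f g h)
    (haux : AuxiliaryOn m ε ρ α Ω f g h s r) {k : Fin M} (hk : k ∈ bright M m) {x t : ℝ}
    (hxt : (x, t) ∈ Ω) :
    Dx 3 (g k) f x t - Dt (g k) f x t - 6 * (S m ε ρ : ℂ) * Dx 1 (g k) f x t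
        + 3 * Complex.I * (A m ε ρ α : ℂ) * (g k x t * f x t)
      = -3 * (∑ i ∈ bright M m, (ε i : ℂ) * conj (g i x t) * s k i x t)
        + 3 * Complex.I *
          ∑ i ∈ dark M m, (ε i : ℂ) * (α i : ℂ) * (ρ i : ℂ) ^ 2 * conj (h i x t) * r k i x t ↔
    EnvelopeEq m ε ρ α (envelope m f g h) k x t := by
  have hΩ := had.isOpen
  have hw := had.smoothOn_envelope
  have hf := had.real_f x t hxt
  have hf0 := had.ne_zero_f x t hxt
  set w := envelope m f g h with hwdef
  have hgk := had.bright_eq hk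
  rw [← hwdef] at hgk
  have hq := (quadratic_iff had hxt).1 (haux.quadratic x t hxt)
  rw [← hwdef] at hq
  have hsum : (∑ i ∈ bright M m, (ε i : ℂ) * conj (g i x t) * s k i x t)
      + -Complex.I *
          ∑ i ∈ dark M m, (ε i : ℂ) * (α i : ℂ) * (ρ i : ℂ) ^ 2 * conj (h i x t) * r k i x t
      = f x t ^ 2 * (density m ε ρ w x t * dx 1 (w k) x t - w k x t * current m ε ρ α w x t) := by
    rw [← sum_wronskian, Finset.mul_sum, Finset.mul_sum, ← sum_bright_add_sum_dark (m := m)]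
    congr 1
    · refine Finset.sum_congr rfl fun i hi => ?_
      have h1 := haux.bright_bright k hk i hi x t hxt
      rw [Dx_one_mul_mul hΩ hxt (hw k) (hw i) had.smooth_f hgk (had.bright_eq hi)] at h1
      rw [had.bright_eq hi x t hxt, map_mul, hf, amplitude_bright hi, waveNumber_bright hi]
      push_cast
      linear_combination -(ε i : ℂ) * conj (w i x t) * h1
    · refine Finset.sum_congr rfl fun i hi => ?_
      have h1 := haux.bright_dark k hk i hi x t hxt
      rw [Dx_one_mul_mul hΩ hxt (hw k) (hw i) had.smooth_f hgk (had.dark_eq hi), hgk x t hxt,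
        had.dark_eq hi x t hxt] at h1
      rw [had.dark_eq hi x t hxt, map_mul, hf, amplitude_dark hi, waveNumber_dark hi]
      linear_combination -(ε i : ℂ) * (ρ i : ℂ) ^ 2 * conj (w i x t) * h1
  rw [Dx_three_mul_self hΩ hxt (hw k) had.smooth_f hgk, Dt_mul_self hΩ hxt (hw k) had.smooth_f hgk,
    Dx_one_mul_self hΩ hxt (hw k) had.smooth_f hgk, hq, hgk x t hxt, EnvelopeEq, frequency,
    waveNumber_bright hk, eq_comm, ← sub_eq_zero, ← sub_eq_zero (b := _ - 3 * w k x t * _)]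
  refine Iff.trans (Eq.congr ?_ rfl) (mul_eq_zero_iff_right (pow_ne_zero 2 hf0))
  push_cast
  linear_combination -3 * hsum

theorem dark_evolution_iff (had : AdmissibleOn m Ω f g h)
    (haux : AuxiliaryOn m ε ρ α Ω f g h s r) {l : Fin M} (hl : l ∈ dark M m) {x t : ℝ}
    (hxt : (x, t) ∈ Ω) :
    Dx 3 (h l) f x t - Dt (h l) f x t + 3 * Complex.I * (α l : ℂ) * Dx 2 (h l) f x t
        - 3 * ((α l : ℂ) ^ 2 + 2 * (S m ε ρ : ℂ)) * Dx 1 (h l) f x t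
        + (-3 * Complex.I * (α l : ℂ) * (S m ε ρ : ℂ) + 3 * Complex.I * (A m ε ρ α : ℂ))
          * (h l x t * f x t)
      = -3 * Complex.I *
          (∑ i ∈ bright M m, (ε i : ℂ) * (α l : ℂ) * conj (g i x t) * r l i x t)
        - 3 * Complex.I *
          ∑ i ∈ dark M m, (ε i : ℂ) * ((α l : ℂ) - (α i : ℂ)) * (ρ i : ℂ) ^ 2
            * conj (h i x t) * r l i x t ↔
    EnvelopeEq m ε ρ α (envelope m f g h) l x t := by
  have hΩ := had.isOpen
  have hw := had.smoothOn_envelope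
  have hf := had.real_f x t hxt
  have hf0 := had.ne_zero_f x t hxt
  set w := envelope m f g h with hwdef
  have hhl := had.dark_eq hl
  rw [← hwdef] at hhl
  have hq := (quadratic_iff had hxt).1 (haux.quadratic x t hxt)
  rw [← hwdef] at hq
  have hsum : Complex.I *
        (∑ i ∈ bright M m, (ε i : ℂ) * (α l : ℂ) * conj (g i x t) * r l i x t)
      + Complex.I * ∑ i ∈ dark M m, (ε i : ℂ) * ((α l : ℂ) - (α i : ℂ)) * (ρ i : ℂ) ^ 2
            * conj (h i x t) * r l i x t
      = f x t ^ 2 * (density m ε ρ w x t * (dx 1 (w l) x t + Complex.I * α l * w l x t)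
        - w l x t * current m ε ρ α w x t) := by
    rw [← sum_wronskian, Finset.mul_sum, Finset.mul_sum, Finset.mul_sum,
      ← sum_bright_add_sum_dark (m := m)]
    congr 1
    · refine Finset.sum_congr rfl fun i hi => ?_
      -- Relation (5) has the bright function first, whereas the dark component l is in front here;
      -- the symmetry of r and the sign change of the Wronskian reconcile the two.
      have h1 := haux.bright_dark i hi l hl x t hxt
      rw [Dx_one_mul_mul hΩ hxt (hw i) (hw l) had.smooth_f (had.bright_eq hi) hhl, hhl x t hxt,
        had.bright_eq hi x t hxt] at h1
      rw [had.bright_eq hi x t hxt, map_mul, hf, amplitude_bright hi, waveNumber_bright hi,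
        haux.r_symm l hl i x t hxt]
      push_cast
      linear_combination (ε i : ℂ) * conj (w i x t) * h1
    · refine Finset.sum_congr rfl fun i hi => ?_
      have h1 := haux.dark_dark l hl i hi x t hxt
      rw [Dx_one_mul_mul hΩ hxt (hw l) (hw i) had.smooth_f hhl (had.dark_eq hi), hhl x t hxt,
        had.dark_eq hi x t hxt] at h1
      rw [had.dark_eq hi x t hxt, map_mul, hf, amplitude_dark hi, waveNumber_dark hi]
      linear_combination -(ε i : ℂ) * (ρ i : ℂ) ^ 2 * conj (w i x t) * h1
  rw [Dx_three_mul_self hΩ hxt (hw l) had.smooth_f hhl, Dt_mul_self hΩ hxt (hw l) had.smooth_f hhl,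
    Dx_two_mul_self hΩ hxt (hw l) had.smooth_f hhl,
    Dx_one_mul_self hΩ hxt (hw l) had.smooth_f hhl, hq, hhl x t hxt, EnvelopeEq, frequency,
    waveNumber_dark hl, eq_comm, ← sub_eq_zero, ← sub_eq_zero (b := _ - 3 * w l x t * _)]
  refine Iff.trans (Eq.congr ?_ rfl) (mul_eq_zero_iff_right (pow_ne_zero 2 hf0))
  push_cast
  linear_combination -3 * hsum

theorem evolutionOn_iff (had : AdmissibleOn m Ω f g h)
    (haux : AuxiliaryOn m ε ρ α Ω f g h s r) :
    EvolutionOn m ε ρ α Ω f g h s r ↔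
      ∀ k x t, (x, t) ∈ Ω → EnvelopeEq m ε ρ α (envelope m f g h) k x t := by
  constructor
  · intro hev k x t hxt
    by_cases hk : k.val < m
    · exact (bright_evolution_iff had haux (mem_bright.2 hk) hxt).1
        (hev.bright k (mem_bright.2 hk) x t hxt)
    · exact (dark_evolution_iff had haux (mem_dark.2 hk) hxt).1
        (hev.dark k (mem_dark.2 hk) x t hxt)
  · intro hev
    exact ⟨fun k hk x t hxt => (bright_evolution_iff had haux hk hxt).2 (hev k x t hxt),
      fun k hk x t hxt => (dark_evolution_iff had haux hk hxt).2 (hev k x t hxt)⟩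

theorem AdmissibleOn.isSolutionOn_iff (had : AdmissibleOn m Ω f g h) :
    IsSolutionOn ε Ω (field m ε ρ α f g h) ↔ ∀ k x t, (x, t) ∈ Ω →
      amplitude m ρ k = 0 ∨ EnvelopeEq m ε ρ α (envelope m f g h) k x t :=
  VectorHirota.isSolutionOn_iff m ε ρ α had.isOpen had.smoothOn_envelope
    (field_eq m ε ρ α f g h)

theorem bilinearization (had : AdmissibleOn m Ω f g h)
    (haux : AuxiliaryOn m ε ρ α Ω f g h s r) :
    (EvolutionOn m ε ρ α Ω f g h s r → IsSolutionOn ε Ω (field m ε ρ α f g h)) ∧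
      ((∀ l ∈ dark M m, ρ l ≠ 0) → IsSolutionOn ε Ω (field m ε ρ α f g h) →
        EvolutionOn m ε ρ α Ω f g h s r) := by
  rw [evolutionOn_iff had haux, had.isSolutionOn_iff]
  refine ⟨fun hev k x t hxt => Or.inr (hev k x t hxt), fun hρ hsol k x t hxt => ?_⟩
  refine (hsol k x t hxt).resolve_left ?_
  by_cases hk : k.val < m
  · rw [amplitude_bright (mem_bright.2 hk)]
    exact one_ne_zero
  · rw [amplitude_dark (mem_dark.2 hk)]
    exact hρ k (mem_dark.2 hk)

end Bilinearization

/-! ### Derivatives of determinants and of solutions of linear systems -/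

section MatrixCalculus

variable {ι : Type*} [Fintype ι] [DecidableEq ι]

/-- Jacobi's formula for the derivative of a determinant. -/
theorem hasDerivAt_det {Y : ℝ → Matrix ι ι ℂ} {Y' : Matrix ι ι ℂ} {s : ℝ}
    (hY : ∀ i j, HasDerivAt (fun y => Y y i j) (Y' i j) s) :
    HasDerivAt (fun y => (Y y).det) (∑ i, ∑ j, (Y s).adjugate i j * Y' j i) s := by
  have h1 : HasDerivAt (fun y => (Y y).det)
      (∑ σ : Equiv.Perm ι, ((Equiv.Perm.sign σ : ℤ) : ℂ) *
        ∑ i, (∏ j ∈ Finset.univ.erase i, Y s (σ j) j) • Y' (σ i) i) s := by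
    simp only [Matrix.det_apply']
    exact HasDerivAt.fun_sum fun σ _ =>
      (HasDerivAt.fun_finsetProd fun i _ => hY (σ i) i).const_mul _
  refine h1.congr_deriv (Eq.symm ?_)
  simp only [Finset.mul_sum]
  conv_rhs => rw [Finset.sum_comm]
  refine Finset.sum_congr rfl fun i _ => ?_
  -- By Cramer's rule the i-th summand is the determinant with column i differentiated.
  have h2 : ∑ j, (Y s).adjugate i j * Y' j i = ((Y s).updateCol i fun j => Y' j i).det := by
    rw [← Matrix.cramer_apply, Matrix.cramer_eq_adjugate_mulVec]
    rfl
  rw [h2, Matrix.det_apply']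
  refine Finset.sum_congr rfl fun σ _ => ?_
  rw [← Finset.mul_prod_erase _ _ (Finset.mem_univ i), Matrix.updateCol_self, smul_eq_mul,
    mul_comm (Y' (σ i) i)]
  congr 2
  refine Finset.prod_congr rfl fun j hj => ?_
  rw [Matrix.updateCol_ne (Finset.ne_of_mem_erase hj)]

theorem contDiff_det {V : Type*} [NormedAddCommGroup V] [NormedSpace ℝ V] {n : ℕ}
    {Y : V → Matrix ι ι ℂ} (hY : ∀ i j, ContDiff ℝ n fun y => Y y i j) :
    ContDiff ℝ n fun y => (Y y).det := by
  simp only [Matrix.det_apply']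
  exact ContDiff.sum fun σ _ => contDiff_const.mul (contDiff_prod fun i _ => hY (σ i) i)

theorem differentiableAt_inv_apply {Y : ℝ → Matrix ι ι ℂ} {s : ℝ}
    (hY : ∀ i j, DifferentiableAt ℝ (fun y => Y y i j) s) (h0 : (Y s).det ≠ 0) (i j : ι) :
    DifferentiableAt ℝ (fun y => (Y y)⁻¹ i j) s := by
  have hdet : ∀ Z : ℝ → Matrix ι ι ℂ, (∀ i j, DifferentiableAt ℝ (fun y => Z y i j) s) →
      DifferentiableAt ℝ (fun y => (Z y).det) s :=
    fun Z hZ => (hasDerivAt_det fun i j => (hZ i j).hasDerivAt).differentiableAt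
  simp only [Matrix.inv_def, Matrix.smul_apply, Ring.inverse_eq_inv', smul_eq_mul,
    Matrix.adjugate_apply]
  refine ((hdet Y hY).inv h0).mul (hdet _ fun a b => ?_)
  by_cases ha : a = j
  · subst ha
    simp only [Matrix.updateRow_self]
    exact differentiableAt_const _
  · simp only [Matrix.updateRow_ne ha]
    exact hY a b

/-- Differentiability of Y⁻¹b comes from the adjugate formula. The value of the derivative then
comes from differentiating Y z = b, which persists near s because det Y stays nonzero there. -/
theorem hasDerivAt_inv_mulVec {Y : ℝ → Matrix ι ι ℂ} {Y' : Matrix ι ι ℂ} {b : ℝ → ι → ℂ}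
    {b' : ι → ℂ} {s : ℝ} (hY : ∀ i j, HasDerivAt (fun y => Y y i j) (Y' i j) s)
    (hb : ∀ i, HasDerivAt (fun y => b y i) (b' i) s) (h0 : (Y s).det ≠ 0) (i : ι) :
    HasDerivAt (fun y => ((Y y)⁻¹.mulVec (b y)) i)
      ((Y s)⁻¹.mulVec (b' - Y'.mulVec ((Y s)⁻¹.mulVec (b s))) i) s := by
  have hd : ∀ i, DifferentiableAt ℝ (fun y => ((Y y)⁻¹.mulVec (b y)) i) s := fun i => by
    simp only [Matrix.mulVec, dotProduct]
    exact DifferentiableAt.fun_sum fun j _ =>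
      (differentiableAt_inv_apply (fun i j => (hY i j).differentiableAt) h0 i j).mul
        (hb j).differentiableAt
  have hcont : ContinuousAt (fun y => (Y y).det) s := (hasDerivAt_det hY).continuousAt
  set z : ℝ → ι → ℂ := fun y => (Y y)⁻¹.mulVec (b y) with hz
  have hsolve : ∀ i, (fun y => ∑ j, Y y i j * z y j) =ᶠ[nhds s] fun y => b y i := fun i => by
    filter_upwards [hcont.eventually_ne h0] with y hy
    have : (Y y).mulVec (z y) = b y := by
      rw [hz, Matrix.mulVec_mulVec, Matrix.mul_nonsing_inv _ (Ne.isUnit hy), Matrix.one_mulVec]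
    exact congrFun this i
  set z' : ι → ℂ := fun i => deriv (fun y => z y i) s with hz'
  have hzd : ∀ i, HasDerivAt (fun y => z y i) (z' i) s := fun i => (hd i).hasDerivAt
  have hder : (Y s).mulVec z' = b' - Y'.mulVec (z s) := by
    ext i
    have h1 : HasDerivAt (fun y => ∑ j, Y y i j * z y j)
        (∑ j, (Y' i j * z s j + Y s i j * z' j)) s :=
      HasDerivAt.fun_sum fun j _ => (hY i j).mul (hzd j)
    have h2 := h1.unique ((hb i).congr_of_eventuallyEq (hsolve i))
    rw [Finset.sum_add_distrib] at h2
    simp only [Pi.sub_apply, Matrix.mulVec, dotProduct]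
    rw [← h2]
    ring
  have hzi : (Y s)⁻¹.mulVec (b' - Y'.mulVec (z s)) = z' := by
    rw [← hder, Matrix.mulVec_mulVec, Matrix.nonsing_inv_mul _ (Ne.isUnit h0), Matrix.one_mulVec]
  rw [hzi]
  exact hzd i

theorem conj_det_of_hermitian {Y : Matrix ι ι ℂ} (hY : ∀ i j, conj (Y i j) = Y j i) :
    conj Y.det = Y.det := by
  have h : Y.conjTranspose = Y := Matrix.ext fun i j => hY j i
  have h1 := Matrix.det_conjTranspose Y
  rw [h] at h1
  exact h1.symm

end MatrixCalculus

/-! ### The Gram matrix of the solitons -/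

section Soliton

variable {M N : ℕ} (m : ℕ) (ε ρ α : Fin M → ℝ) (p ξ₀ : Fin N → ℂ) (C : Fin M → Fin N → ℂ)

/-- The exponential `exp(ξ_i)`. -/
noncomputable def wave (i : Fin N) (x t : ℝ) : ℂ := Complex.exp (phase m ε ρ p ξ₀ i x t)

/-- The solution `M_0⁻¹ P^n Φ` of the linear system, with `P` the diagonal matrix of the `p_i`. -/
noncomputable def resolved (n : ℕ) (x t : ℝ) : Fin N → ℂ :=
  (mat m ε ρ α p ξ₀ C 0 x t)⁻¹.mulVec fun i => p i ^ n * wave m ε ρ p ξ₀ i x t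

/-- The pairing `Φ^† (P^*)^a M_0⁻¹ P^n Φ`. -/
noncomputable def pairing (a n : ℕ) (x t : ℝ) : ℂ :=
  ∑ j, conj (wave m ε ρ p ξ₀ j x t) * conj (p j) ^ a * resolved m ε ρ α p ξ₀ C n x t j

/-- The matrix `B` with `P M_0 + M_0 P^* = Φ Φ^† + B`. -/
noncomputable def source (i j : Fin N) : ℂ :=
  (∑ l ∈ bright M m, (ε l : ℂ) * conj (C l i) * C l j) / gram m ε ρ α p i j

variable {m ε ρ α p ξ₀ C}

/-- The diagonal case of p_i + p_j^* ≠ 0 means Re p_i ≠ 0, so p_i^* + iα never vanishes for real α.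
-/
theorem add_I_mul_ne_zero {z : ℂ} (hz : z + conj z ≠ 0) (a : ℝ) :
    conj z + Complex.I * a ≠ 0 := by
  intro h
  apply hz
  have h1 := congrArg Complex.re h
  simp only [Complex.add_re, Complex.conj_re, Complex.mul_re, Complex.I_re, Complex.I_im,
    Complex.ofReal_re, Complex.ofReal_im, Complex.zero_re] at h1
  rw [Complex.add_conj]
  have : z.re = 0 := by linarith
  simp [this]

theorem sub_I_mul_ne_zero {z : ℂ} (hz : z + conj z ≠ 0) (a : ℝ) : z - Complex.I * a ≠ 0 := by
  intro h
  apply add_I_mul_ne_zero hz a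
  have := congrArg conj h
  simpa using this

theorem mat_zero_apply (x t : ℝ) (i j : Fin N) :
    mat m ε ρ α p ξ₀ C 0 x t i j = (wave m ε ρ p ξ₀ i x t * conj (wave m ε ρ p ξ₀ j x t)
      + source m ε ρ α p C i j) / (p i + conj (p j)) := by
  simp only [mat, Matrix.of_apply, Pi.zero_apply, zpow_zero, Finset.prod_const_one, mul_one, wave,
    source, Complex.exp_add, ← Complex.exp_conj]
  rw [add_div, div_div, mul_comm (gram m ε ρ α p i j)]
  ring

/-- Since -(p - iα)/(p^* + iα) = 1 - (p + p^*)/(p^* + iα), the denominator p + p^* cancels and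
M_{e_l} is a rank-one perturbation of M_0. -/
theorem mat_single_apply (hp : ∀ i j, p i + conj (p j) ≠ 0) {l : Fin M} (hl : l ∈ dark M m)
    (x t : ℝ) (i j : Fin N) :
    mat m ε ρ α p ξ₀ C (Pi.single l 1) x t i j = mat m ε ρ α p ξ₀ C 0 x t i j
      - wave m ε ρ p ξ₀ i x t *
        (conj (wave m ε ρ p ξ₀ j x t) / (conj (p j) + Complex.I * (α l : ℂ))) := by
  have hprod : ∏ a ∈ dark M m, (-((p i - Complex.I * (α a : ℂ)) /
      (conj (p j) + Complex.I * (α a : ℂ)))) ^ (Pi.single l 1 : Fin M → ℤ) a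
      = -((p i - Complex.I * (α l : ℂ)) / (conj (p j) + Complex.I * (α l : ℂ))) := by
    rw [Finset.prod_eq_single_of_mem l hl fun b _ hb => by rw [Pi.single_eq_of_ne hb, zpow_zero],
      Pi.single_eq_same, zpow_one]
  simp only [mat, Matrix.of_apply, hprod, Pi.zero_apply, zpow_zero, Finset.prod_const_one, mul_one,
    wave, Complex.exp_add, ← Complex.exp_conj]
  have h1 := hp i j
  have h2 := add_I_mul_ne_zero (hp j j) (α l)
  have h3 : -((p i - Complex.I * (α l : ℂ)) / (conj (p j) + Complex.I * (α l : ℂ)))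
      = 1 - (p i + conj (p j)) / (conj (p j) + Complex.I * (α l : ℂ)) := by
    field_simp
    ring
  rw [h3]
  field_simp
  ring

theorem conj_gram (i j : Fin N) : conj (gram m ε ρ α p i j) = gram m ε ρ α p j i := by
  simp only [gram, map_sub, map_sum, map_div₀, map_mul, map_pow, map_add, Complex.conj_ofReal,
    Complex.conj_conj, Complex.conj_I, map_one]
  congr 1
  refine Finset.sum_congr rfl fun l _ => ?_
  congr 1
  ring

theorem conj_source (i j : Fin N) : conj (source m ε ρ α p C i j) = source m ε ρ α p C j i := by
  simp only [source, map_div₀, conj_gram, map_sum, map_mul, Complex.conj_ofReal, Complex.conj_conj]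
  congr 1
  exact Finset.sum_congr rfl fun l _ => by ring

theorem conj_mat_zero (x t : ℝ) (i j : Fin N) :
    conj (mat m ε ρ α p ξ₀ C 0 x t i j) = mat m ε ρ α p ξ₀ C 0 x t j i := by
  simp only [mat_zero_apply, map_div₀, map_add, map_mul, Complex.conj_conj, conj_source]
  congr 1 <;> ring

theorem conj_tauF (x t : ℝ) :
    conj (tauF m ε ρ α p ξ₀ C x t) = tauF m ε ρ α p ξ₀ C x t := by
  exact conj_det_of_hermitian (conj_mat_zero x t)

theorem hasDerivAt_wave_fst (i : Fin N) (x t : ℝ) :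
    HasDerivAt (fun y => wave m ε ρ p ξ₀ i y t) (p i * wave m ε ρ p ξ₀ i x t) x := by
  have h1 : HasDerivAt (fun y : ℝ => phase m ε ρ p ξ₀ i y t) (p i) x := by
    simp only [phase]
    simpa using ((((hasDerivAt_id x).ofReal_comp).sub_const (3 * (S m ε ρ : ℂ) * t)).const_mul
      (p i)).add_const (p i ^ 3 * (t : ℂ)) |>.add_const (ξ₀ i)
  exact h1.cexp.congr_deriv (mul_comm _ _)

theorem hasDerivAt_wave_snd (i : Fin N) (x t : ℝ) :
    HasDerivAt (fun y => wave m ε ρ p ξ₀ i x y)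
      ((p i ^ 3 - 3 * (S m ε ρ : ℂ) * p i) * wave m ε ρ p ξ₀ i x t) t := by
  have h1 : HasDerivAt (fun y : ℝ => phase m ε ρ p ξ₀ i x y)
      (p i ^ 3 - 3 * (S m ε ρ : ℂ) * p i) t := by
    have h2 : (fun y : ℝ => phase m ε ρ p ξ₀ i x y) = fun y : ℝ =>
        (p i ^ 3 - 3 * (S m ε ρ : ℂ) * p i) * (y : ℂ) + (p i * x + ξ₀ i) := by
      ext y
      simp only [phase]
      ring
    rw [h2]
    simpa using (((hasDerivAt_id t).ofReal_comp).const_mul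
      (p i ^ 3 - 3 * (S m ε ρ : ℂ) * p i)).add_const (p i * (x : ℂ) + ξ₀ i)
  exact h1.cexp.congr_deriv (mul_comm _ _)

theorem hasDerivAt_conj {u : ℝ → ℂ} {u' : ℂ} {s : ℝ} (h : HasDerivAt u u' s) :
    HasDerivAt (fun y => conj (u y)) (conj u') s :=
  (Complex.conjCLE.toContinuousLinearMap.hasFDerivAt.comp_hasDerivAt s h)

/-- Differentiating e^{ξ_i + ξ_j^*} produces exactly the factor p_i + p_j^* of the denominator. -/
theorem hasDerivAt_mat_fst (hp : ∀ i j, p i + conj (p j) ≠ 0) (x t : ℝ) (i j : Fin N) :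
    HasDerivAt (fun y => mat m ε ρ α p ξ₀ C 0 y t i j)
      (wave m ε ρ p ξ₀ i x t * conj (wave m ε ρ p ξ₀ j x t)) x := by
  simp only [mat_zero_apply]
  have hw : ∀ k, HasDerivAt (fun y => wave m ε ρ p ξ₀ k y t) _ x :=
    fun k => hasDerivAt_wave_fst k x t
  refine ((((hw i).mul (hasDerivAt_conj (hw j))).add_const
    (source m ε ρ α p C i j)).div_const (p i + conj (p j))).congr_deriv (Eq.symm ?_)
  have := hp i j
  rw [eq_div_iff this, map_mul]
  ring

/-- The dispersion relation gives (p³ + q³ - 3S(p + q))/(p + q) with q = p_j^*, which is a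
polynomial. -/
theorem hasDerivAt_mat_snd (hp : ∀ i j, p i + conj (p j) ≠ 0) (x t : ℝ) (i j : Fin N) :
    HasDerivAt (fun y => mat m ε ρ α p ξ₀ C 0 x y i j)
      ((p i ^ 2 - p i * conj (p j) + conj (p j) ^ 2 - 3 * (S m ε ρ : ℂ)) *
        (wave m ε ρ p ξ₀ i x t * conj (wave m ε ρ p ξ₀ j x t))) t := by
  simp only [mat_zero_apply]
  have hw : ∀ k, HasDerivAt (fun y => wave m ε ρ p ξ₀ k x y) _ t :=
    fun k => hasDerivAt_wave_snd k x t
  refine ((((hw i).mul (hasDerivAt_conj (hw j))).add_const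
    (source m ε ρ α p C i j)).div_const (p i + conj (p j))).congr_deriv (Eq.symm ?_)
  have := hp i j
  rw [eq_div_iff this]
  simp only [map_mul, map_sub, map_pow, Complex.conj_ofReal, map_ofNat]
  ring

theorem mulVec_resolved {x t : ℝ} (h0 : tauF m ε ρ α p ξ₀ C x t ≠ 0) (n : ℕ) (i : Fin N) :
    ∑ j, mat m ε ρ α p ξ₀ C 0 x t i j * resolved m ε ρ α p ξ₀ C n x t j
      = p i ^ n * wave m ε ρ p ξ₀ i x t := by
  have : (mat m ε ρ α p ξ₀ C 0 x t).mulVec (resolved m ε ρ α p ξ₀ C n x t)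
      = fun i => p i ^ n * wave m ε ρ p ξ₀ i x t := by
    rw [resolved, Matrix.mulVec_mulVec, Matrix.mul_nonsing_inv _ (Ne.isUnit h0), Matrix.one_mulVec]
  exact congrFun this i

/-- The resolved vectors depend linearly on the right-hand side. -/
theorem inv_mulVec_eq_sum {x t : ℝ} {b : Fin N → ℂ} (c : ℕ → ℂ) (K : ℕ)
    (hb : ∀ i, b i = ∑ n ∈ Finset.range K, c n * (p i ^ n * wave m ε ρ p ξ₀ i x t)) (i : Fin N) :
    (mat m ε ρ α p ξ₀ C 0 x t)⁻¹.mulVec b i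
      = ∑ n ∈ Finset.range K, c n * resolved m ε ρ α p ξ₀ C n x t i := by
  simp only [resolved, Matrix.mulVec, dotProduct, hb, Finset.mul_sum]
  rw [Finset.sum_comm]
  exact Finset.sum_congr rfl fun n _ => Finset.sum_congr rfl fun j _ => by ring

/-- Since M_x = ΦΦ^†, the correction M⁻¹ M_x z_n is the scalar Φ^† z_n times z_0. -/
theorem hasDerivAt_resolved_fst (hp : ∀ i j, p i + conj (p j) ≠ 0) {x t : ℝ}
    (h0 : tauF m ε ρ α p ξ₀ C x t ≠ 0) (n : ℕ) (i : Fin N) :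
    HasDerivAt (fun y => resolved m ε ρ α p ξ₀ C n y t i)
      (resolved m ε ρ α p ξ₀ C (n + 1) x t i
        - pairing m ε ρ α p ξ₀ C 0 n x t * resolved m ε ρ α p ξ₀ C 0 x t i) x := by
  have h := hasDerivAt_inv_mulVec (Y := fun y => mat m ε ρ α p ξ₀ C 0 y t)
    (Y' := Matrix.of fun i j => wave m ε ρ p ξ₀ i x t * conj (wave m ε ρ p ξ₀ j x t))
    (b := fun y i => p i ^ n * wave m ε ρ p ξ₀ i y t)
    (b' := fun i => p i ^ (n + 1) * wave m ε ρ p ξ₀ i x t) (hasDerivAt_mat_fst hp x t)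
    (fun i => by
      refine ((hasDerivAt_wave_fst i x t).const_mul (p i ^ n)).congr_deriv ?_
      rw [pow_succ, mul_assoc]) h0 i
  refine h.congr_deriv ?_
  have hb : ∀ b : Fin N → ℂ, b = (fun i => p i ^ (n + 1) * wave m ε ρ p ξ₀ i x t
      - pairing m ε ρ α p ξ₀ C 0 n x t * (p i ^ 0 * wave m ε ρ p ξ₀ i x t)) →
      (mat m ε ρ α p ξ₀ C 0 x t)⁻¹.mulVec b i = resolved m ε ρ α p ξ₀ C (n + 1) x t i
        - pairing m ε ρ α p ξ₀ C 0 n x t * resolved m ε ρ α p ξ₀ C 0 x t i := by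
    rintro b rfl
    simp only [resolved, Matrix.mulVec, dotProduct, Finset.mul_sum, ← Finset.sum_sub_distrib]
    exact Finset.sum_congr rfl fun j _ => by ring
  apply hb
  ext k
  simp only [Pi.sub_apply, Matrix.mulVec, dotProduct, Matrix.of_apply, pairing, Finset.sum_mul,
    resolved, pow_zero, mul_one, one_mul]
  congr 1
  exact Finset.sum_congr rfl fun j _ => by ring

theorem hasDerivAt_resolved_snd (hp : ∀ i j, p i + conj (p j) ≠ 0) {x t : ℝ}
    (h0 : tauF m ε ρ α p ξ₀ C x t ≠ 0) (i : Fin N) :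
    HasDerivAt (fun y => resolved m ε ρ α p ξ₀ C 0 x y i)
      (resolved m ε ρ α p ξ₀ C 3 x t i - 3 * (S m ε ρ : ℂ) * resolved m ε ρ α p ξ₀ C 1 x t i
        + (3 * (S m ε ρ : ℂ) * pairing m ε ρ α p ξ₀ C 0 0 x t - pairing m ε ρ α p ξ₀ C 2 0 x t)
          * resolved m ε ρ α p ξ₀ C 0 x t i
        + pairing m ε ρ α p ξ₀ C 1 0 x t * resolved m ε ρ α p ξ₀ C 1 x t i
        - pairing m ε ρ α p ξ₀ C 0 0 x t * resolved m ε ρ α p ξ₀ C 2 x t i) t := by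
  have h := hasDerivAt_inv_mulVec (Y := fun y => mat m ε ρ α p ξ₀ C 0 x y)
    (Y' := Matrix.of fun i j => (p i ^ 2 - p i * conj (p j) + conj (p j) ^ 2
      - 3 * (S m ε ρ : ℂ)) * (wave m ε ρ p ξ₀ i x t * conj (wave m ε ρ p ξ₀ j x t)))
    (b := fun y i => p i ^ 0 * wave m ε ρ p ξ₀ i x y)
    (b' := fun i => (p i ^ 3 - 3 * (S m ε ρ : ℂ) * p i) * wave m ε ρ p ξ₀ i x t)
    (hasDerivAt_mat_snd hp x t)
    (fun i => by
      simp only [pow_zero, one_mul]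
      exact hasDerivAt_wave_snd i x t) h0 i
  refine h.congr_deriv ?_
  -- These are the coefficients of 1, p, p², p³ in the factor multiplying Φ in Φ_t - M_t z_0.
  rw [inv_mulVec_eq_sum (fun n => if n = 0 then 3 * (S m ε ρ : ℂ) * pairing m ε ρ α p ξ₀ C 0 0 x t
    - pairing m ε ρ α p ξ₀ C 2 0 x t else if n = 1 then pairing m ε ρ α p ξ₀ C 1 0 x t
    - 3 * (S m ε ρ : ℂ) else if n = 2 then -pairing m ε ρ α p ξ₀ C 0 0 x t else 1) 4]
  · simp only [Finset.sum_range_succ, Finset.sum_range_zero]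
    norm_num
    ring
  · intro k
    have hsum : ∑ j, (p k ^ 2 - p k * conj (p j) + conj (p j) ^ 2 - 3 * (S m ε ρ : ℂ)) *
        (wave m ε ρ p ξ₀ k x t * conj (wave m ε ρ p ξ₀ j x t)) * resolved m ε ρ α p ξ₀ C 0 x t j
        = wave m ε ρ p ξ₀ k x t * ((p k ^ 2 - 3 * (S m ε ρ : ℂ)) * pairing m ε ρ α p ξ₀ C 0 0 x t
          - p k * pairing m ε ρ α p ξ₀ C 1 0 x t + pairing m ε ρ α p ξ₀ C 2 0 x t) := by
      simp only [pairing, Finset.mul_sum, ← Finset.sum_sub_distrib, ← Finset.sum_add_distrib]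
      exact Finset.sum_congr rfl fun j _ => by ring
    refine (congrArg (fun z => (p k ^ 3 - 3 * (S m ε ρ : ℂ) * p k) * wave m ε ρ p ξ₀ k x t - z)
      hsum).trans ?_
    simp only [Finset.sum_range_succ, Finset.sum_range_zero]
    norm_num
    ring

theorem hasDerivAt_pairing_fst (hp : ∀ i j, p i + conj (p j) ≠ 0) {x t : ℝ}
    (h0 : tauF m ε ρ α p ξ₀ C x t ≠ 0) (a n : ℕ) :
    HasDerivAt (fun y => pairing m ε ρ α p ξ₀ C a n y t)
      (pairing m ε ρ α p ξ₀ C (a + 1) n x t + pairing m ε ρ α p ξ₀ C a (n + 1) x t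
        - pairing m ε ρ α p ξ₀ C 0 n x t * pairing m ε ρ α p ξ₀ C a 0 x t) x := by
  have h : HasDerivAt (fun y => pairing m ε ρ α p ξ₀ C a n y t) _ x :=
    HasDerivAt.fun_sum fun j _ =>
      ((hasDerivAt_conj (hasDerivAt_wave_fst j x t)).mul_const (conj (p j) ^ a)).mul
        (hasDerivAt_resolved_fst hp h0 n j)
  refine h.congr_deriv ?_
  rw [pairing, pairing, pairing, pairing, Finset.mul_sum, ← Finset.sum_add_distrib,
    ← Finset.sum_sub_distrib]
  refine Finset.sum_congr rfl fun j _ => ?_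
  rw [map_mul]
  ring

/-- Jacobi's formula with M_x = ΦΦ^† gives (log f)_x = Φ^† M⁻¹ Φ. -/
theorem hasDerivAt_tauF (hp : ∀ i j, p i + conj (p j) ≠ 0) {x t : ℝ}
    (h0 : tauF m ε ρ α p ξ₀ C x t ≠ 0) :
    HasDerivAt (fun y => tauF m ε ρ α p ξ₀ C y t)
      (tauF m ε ρ α p ξ₀ C x t * pairing m ε ρ α p ξ₀ C 0 0 x t) x := by
  refine (hasDerivAt_det (Y := fun y => mat m ε ρ α p ξ₀ C 0 y t)
    (Y' := Matrix.of fun i j => wave m ε ρ p ξ₀ i x t * conj (wave m ε ρ p ξ₀ j x t))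
    (hasDerivAt_mat_fst hp x t)).congr_deriv ?_
  rw [pairing, Finset.mul_sum]
  refine Finset.sum_congr rfl fun i _ => ?_
  rw [resolved, Matrix.inv_def, Ring.inverse_eq_inv', Matrix.smul_mulVec, Pi.smul_apply,
    smul_eq_mul, Matrix.mulVec, dotProduct, Finset.mul_sum, Finset.mul_sum, Finset.mul_sum]
  refine Finset.sum_congr rfl fun j _ => ?_
  have h0' : (mat m ε ρ α p ξ₀ C 0 x t).det ≠ 0 := h0
  simp only [tauF, Matrix.of_apply]
  field_simp

end Soliton

/-! ### Pairings of the resolved vectors -/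

section Soliton

variable {M N : ℕ} (m : ℕ) (ε ρ α : Fin M → ℝ) (p ξ₀ : Fin N → ℂ) (C : Fin M → Fin N → ℂ)

/-- The pairing `Φ^† (P^* + i a)⁻¹ M_0⁻¹ P^n Φ`. -/
noncomputable def darkPairing (a : ℝ) (n : ℕ) (x t : ℝ) : ℂ :=
  ∑ j, conj (wave m ε ρ p ξ₀ j x t) / (conj (p j) + Complex.I * a)
    * resolved m ε ρ α p ξ₀ C n x t j

/-- The pairing `Φ^† M_0⁻¹ (P - i a)⁻¹ P^n Φ`. -/
noncomputable def adjointPairing (a : ℝ) (n : ℕ) (x t : ℝ) : ℂ :=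
  ∑ i, conj (resolved m ε ρ α p ξ₀ C 0 x t i) / (p i - Complex.I * a)
    * (p i ^ n * wave m ε ρ p ξ₀ i x t)

/-- The pairing of `M_0⁻¹ P^n Φ` with the coefficients of the `k`-th bright component. -/
noncomputable def brightPairing (k : Fin M) (n : ℕ) (x t : ℝ) : ℂ :=
  ∑ j, C k j * resolved m ε ρ α p ξ₀ C n x t j

/-- The derivative of `pairing 0 0`, that is `(log f)_xx`. -/
noncomputable def curvature (x t : ℝ) : ℂ :=
  pairing m ε ρ α p ξ₀ C 1 0 x t + pairing m ε ρ α p ξ₀ C 0 1 x t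
    - pairing m ε ρ α p ξ₀ C 0 0 x t ^ 2

/-- The derivative of `pairing 0 1 - (pairing 0 0)² / 2`. -/
noncomputable def torsion (x t : ℝ) : ℂ :=
  pairing m ε ρ α p ξ₀ C 1 1 x t + pairing m ε ρ α p ξ₀ C 0 2 x t
    - pairing m ε ρ α p ξ₀ C 0 1 x t * pairing m ε ρ α p ξ₀ C 0 0 x t
    - pairing m ε ρ α p ξ₀ C 0 0 x t * curvature m ε ρ α p ξ₀ C x t

variable {m ε ρ α p ξ₀ C} {x t : ℝ}

/-! ### Algebraic identities for the pairings -/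

/-- M_0 is Hermitian, so M z_0 = Φ conjugates to z_0^† M = Φ^†. -/
theorem conj_resolved_mul_mat (h0 : tauF m ε ρ α p ξ₀ C x t ≠ 0) (j : Fin N) :
    ∑ i, conj (resolved m ε ρ α p ξ₀ C 0 x t i) * mat m ε ρ α p ξ₀ C 0 x t i j
      = conj (wave m ε ρ p ξ₀ j x t) := by
  have h := congrArg conj (mulVec_resolved h0 0 j)
  rw [map_sum, pow_zero, one_mul] at h
  rw [← h]
  refine Finset.sum_congr rfl fun i _ => ?_
  rw [map_mul, conj_mat_zero, mul_comm]

theorem sum_conj_resolved_mul_mat (h0 : tauF m ε ρ α p ξ₀ C x t ≠ 0) (z : Fin N → ℂ) :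
    ∑ i, ∑ j, conj (resolved m ε ρ α p ξ₀ C 0 x t i) * mat m ε ρ α p ξ₀ C 0 x t i j * z j
      = ∑ j, conj (wave m ε ρ p ξ₀ j x t) * z j := by
  rw [Finset.sum_comm]
  refine Finset.sum_congr rfl fun j _ => ?_
  rw [← Finset.sum_mul, conj_resolved_mul_mat h0]

theorem sum_mat_mul_resolved (h0 : tauF m ε ρ α p ξ₀ C x t ≠ 0) (n : ℕ) (z : Fin N → ℂ) :
    ∑ i, ∑ j, z i * (mat m ε ρ α p ξ₀ C 0 x t i j * resolved m ε ρ α p ξ₀ C n x t j)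
      = ∑ i, z i * (p i ^ n * wave m ε ρ p ξ₀ i x t) := by
  refine Finset.sum_congr rfl fun i _ => ?_
  rw [← Finset.mul_sum, mulVec_resolved h0]

theorem sum_conj_resolved_mul_wave (h0 : tauF m ε ρ α p ξ₀ C x t ≠ 0) (n : ℕ) :
    ∑ i, conj (resolved m ε ρ α p ξ₀ C 0 x t i) * (p i ^ n * wave m ε ρ p ξ₀ i x t)
      = pairing m ε ρ α p ξ₀ C 0 n x t := by
  rw [← sum_mat_mul_resolved h0]
  simp only [← mul_assoc]
  rw [sum_conj_resolved_mul_mat h0, pairing]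
  exact Finset.sum_congr rfl fun j _ => by ring

theorem source_eq (hp : ∀ i j, p i + conj (p j) ≠ 0) (i j : Fin N) :
    source m ε ρ α p C i j = (p i + conj (p j)) * mat m ε ρ α p ξ₀ C 0 x t i j
      - wave m ε ρ p ξ₀ i x t * conj (wave m ε ρ p ξ₀ j x t) := by
  rw [mat_zero_apply, mul_div_cancel₀ _ (hp i j)]
  ring

/-- Sandwich B = P M + M P^* - ΦΦ^† between z_0^† and z_n; M is absorbed on the right in the first
term and on the left in the second. -/
theorem sum_source_bright (hp : ∀ i j, p i + conj (p j) ≠ 0)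
    (h0 : tauF m ε ρ α p ξ₀ C x t ≠ 0) (n : ℕ) :
    ∑ i, ∑ j, conj (resolved m ε ρ α p ξ₀ C 0 x t i) * source m ε ρ α p C i j
        * resolved m ε ρ α p ξ₀ C n x t j
      = pairing m ε ρ α p ξ₀ C 0 (n + 1) x t + pairing m ε ρ α p ξ₀ C 1 n x t
        - pairing m ε ρ α p ξ₀ C 0 0 x t * pairing m ε ρ α p ξ₀ C 0 n x t := by
  have h1 := sum_mat_mul_resolved h0 n
    fun i => conj (resolved m ε ρ α p ξ₀ C 0 x t i) * p i
  have h2 := sum_conj_resolved_mul_mat h0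
    fun j => conj (p j) * resolved m ε ρ α p ξ₀ C n x t j
  have h3 := sum_conj_resolved_mul_wave h0 (n + 1)
  have h4 := sum_conj_resolved_mul_wave h0 0
  have h5 : pairing m ε ρ α p ξ₀ C 1 n x t
      = ∑ j, conj (wave m ε ρ p ξ₀ j x t) * (conj (p j) * resolved m ε ρ α p ξ₀ C n x t j) :=
    Finset.sum_congr rfl fun j _ => by ring
  have h6 : ∑ i, conj (resolved m ε ρ α p ξ₀ C 0 x t i) * p i *
        (p i ^ n * wave m ε ρ p ξ₀ i x t) = pairing m ε ρ α p ξ₀ C 0 (n + 1) x t := by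
    rw [← h3]
    exact Finset.sum_congr rfl fun j _ => by ring
  rw [← h6, ← h1, h5, ← h2, ← h4, pairing, Finset.sum_mul_sum]
  simp only [← Finset.sum_add_distrib, ← Finset.sum_sub_distrib]
  refine Finset.sum_congr rfl fun i _ => Finset.sum_congr rfl fun j _ => ?_
  rw [source_eq (ξ₀ := ξ₀) (x := x) (t := t) hp]
  ring

/-- The same sandwich after division by (p_i - ia)(p_j^* + ia), using (p + q)/((p - ia)(q + ia)) =
1/(p - ia) + 1/(q + ia). -/
theorem sum_source_dark (hp : ∀ i j, p i + conj (p j) ≠ 0)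
    (h0 : tauF m ε ρ α p ξ₀ C x t ≠ 0) (a : ℝ) (n : ℕ) :
    ∑ i, ∑ j, conj (resolved m ε ρ α p ξ₀ C 0 x t i) * (source m ε ρ α p C i j /
        ((p i - Complex.I * a) * (conj (p j) + Complex.I * a))) * resolved m ε ρ α p ξ₀ C n x t j
      = darkPairing m ε ρ α p ξ₀ C a n x t + adjointPairing m ε ρ α p ξ₀ C a n x t
        - adjointPairing m ε ρ α p ξ₀ C a 0 x t * darkPairing m ε ρ α p ξ₀ C a n x t := by
  have h1 := sum_mat_mul_resolved h0 n
    fun i => conj (resolved m ε ρ α p ξ₀ C 0 x t i) / (p i - Complex.I * a)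
  have h2 := sum_conj_resolved_mul_mat h0
    fun j => resolved m ε ρ α p ξ₀ C n x t j / (conj (p j) + Complex.I * a)
  have h5 : darkPairing m ε ρ α p ξ₀ C a n x t
      = ∑ j, conj (wave m ε ρ p ξ₀ j x t) *
        (resolved m ε ρ α p ξ₀ C n x t j / (conj (p j) + Complex.I * a)) :=
    Finset.sum_congr rfl fun j _ => by ring
  have h6 : adjointPairing m ε ρ α p ξ₀ C a 0 x t * darkPairing m ε ρ α p ξ₀ C a n x t
      = ∑ i, ∑ j, conj (resolved m ε ρ α p ξ₀ C 0 x t i) / (p i - Complex.I * a)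
        * (p i ^ 0 * wave m ε ρ p ξ₀ i x t) * (conj (wave m ε ρ p ξ₀ j x t)
        / (conj (p j) + Complex.I * a) * resolved m ε ρ α p ξ₀ C n x t j) := by
    rw [adjointPairing, darkPairing, Finset.sum_mul_sum]
  rw [h6, adjointPairing, ← h1, h5, ← h2]
  simp only [← Finset.sum_add_distrib, ← Finset.sum_sub_distrib]
  refine Finset.sum_congr rfl fun i _ => Finset.sum_congr rfl fun j _ => ?_
  rw [source_eq (ξ₀ := ξ₀) (x := x) (t := t) hp]
  have h7 := sub_I_mul_ne_zero (hp i i) a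
  have h8 := add_I_mul_ne_zero (hp j j) a
  field_simp
  ring

theorem conj_darkPairing (a : ℝ) :
    conj (darkPairing m ε ρ α p ξ₀ C a 0 x t) = adjointPairing m ε ρ α p ξ₀ C a 0 x t := by
  rw [darkPairing, adjointPairing, map_sum]
  refine Finset.sum_congr rfl fun i _ => ?_
  simp only [map_mul, map_div₀, map_add, Complex.conj_conj, Complex.conj_I, Complex.conj_ofReal]
  ring

theorem adjointPairing_one (hp : ∀ i j, p i + conj (p j) ≠ 0)
    (h0 : tauF m ε ρ α p ξ₀ C x t ≠ 0) (a : ℝ) :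
    adjointPairing m ε ρ α p ξ₀ C a 1 x t = pairing m ε ρ α p ξ₀ C 0 0 x t
      + Complex.I * a * adjointPairing m ε ρ α p ξ₀ C a 0 x t := by
  rw [← sum_conj_resolved_mul_wave h0, adjointPairing, adjointPairing, Finset.mul_sum,
    ← Finset.sum_add_distrib]
  refine Finset.sum_congr rfl fun i _ => ?_
  have h7 := sub_I_mul_ne_zero (hp i i) a
  field_simp
  ring

/-- The relation between bright and dark coefficients that underlies the whole construction. -/
theorem sum_bright_pairing (hp : ∀ i j, p i + conj (p j) ≠ 0)
    (hG : ∀ i j, gram m ε ρ α p i j ≠ 0) (h0 : tauF m ε ρ α p ξ₀ C x t ≠ 0) (n : ℕ) :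
    ∑ k ∈ bright M m, (ε k : ℂ) * (conj (brightPairing m ε ρ α p ξ₀ C k 0 x t)
        * brightPairing m ε ρ α p ξ₀ C k n x t)
      = ∑ l ∈ dark M m, (ε l : ℂ) * (ρ l : ℂ) ^ 2 *
          (darkPairing m ε ρ α p ξ₀ C (α l) n x t + adjointPairing m ε ρ α p ξ₀ C (α l) n x t
          - adjointPairing m ε ρ α p ξ₀ C (α l) 0 x t * darkPairing m ε ρ α p ξ₀ C (α l) n x t)
        - (pairing m ε ρ α p ξ₀ C 0 (n + 1) x t + pairing m ε ρ α p ξ₀ C 1 n x t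
          - pairing m ε ρ α p ξ₀ C 0 0 x t * pairing m ε ρ α p ξ₀ C 0 n x t) := by
  simp only [← sum_source_dark hp h0, ← sum_source_bright hp h0, brightPairing, map_sum, map_mul,
    Finset.sum_mul_sum]
  simp only [Finset.mul_sum]
  -- The index sums i, j are moved outside, so that the claim reduces to the definition of G_ij for
  -- each pair.
  rw [Finset.sum_comm, Finset.sum_comm (s := dark M m), ← Finset.sum_sub_distrib]
  refine Finset.sum_congr rfl fun i _ => ?_
  rw [Finset.sum_comm, Finset.sum_comm (s := dark M m), ← Finset.sum_sub_distrib]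
  refine Finset.sum_congr rfl fun j _ => ?_
  have h1 : ∑ l ∈ bright M m, (ε l : ℂ) * conj (C l i) * C l j
      = source m ε ρ α p C i j * gram m ε ρ α p i j := by
    rw [source, div_mul_cancel₀ _ (hG i j)]
  have h2 : ∑ l ∈ bright M m, (ε l : ℂ) * (conj (C l i) * conj (resolved m ε ρ α p ξ₀ C 0 x t i)
        * (C l j * resolved m ε ρ α p ξ₀ C n x t j))
      = (source m ε ρ α p C i j * gram m ε ρ α p i j) * (conj (resolved m ε ρ α p ξ₀ C 0 x t i)
        * resolved m ε ρ α p ξ₀ C n x t j) := by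
    rw [← h1, Finset.sum_mul]
    exact Finset.sum_congr rfl fun l _ => by ring
  rw [h2, gram, mul_sub, sub_mul, Finset.mul_sum, Finset.sum_mul]
  congr 1
  · exact Finset.sum_congr rfl fun l _ => by ring
  · ring

/-! ### Derivatives of the pairings -/

theorem hasDerivAt_brightPairing_fst (hp : ∀ i j, p i + conj (p j) ≠ 0)
    (h0 : tauF m ε ρ α p ξ₀ C x t ≠ 0) (k : Fin M) (n : ℕ) :
    HasDerivAt (fun y => brightPairing m ε ρ α p ξ₀ C k n y t)
      (brightPairing m ε ρ α p ξ₀ C k (n + 1) x t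
        - pairing m ε ρ α p ξ₀ C 0 n x t * brightPairing m ε ρ α p ξ₀ C k 0 x t) x := by
  have h : HasDerivAt (fun y => brightPairing m ε ρ α p ξ₀ C k n y t) _ x :=
    HasDerivAt.fun_sum fun j _ => (hasDerivAt_resolved_fst hp h0 n j).const_mul (C k j)
  refine h.congr_deriv ?_
  rw [brightPairing, brightPairing, Finset.mul_sum, ← Finset.sum_sub_distrib]
  exact Finset.sum_congr rfl fun j _ => by ring

theorem hasDerivAt_brightPairing_snd (hp : ∀ i j, p i + conj (p j) ≠ 0)
    (h0 : tauF m ε ρ α p ξ₀ C x t ≠ 0) (k : Fin M) :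
    HasDerivAt (fun y => brightPairing m ε ρ α p ξ₀ C k 0 x y)
      (brightPairing m ε ρ α p ξ₀ C k 3 x t
        - 3 * (S m ε ρ : ℂ) * brightPairing m ε ρ α p ξ₀ C k 1 x t
        + (3 * (S m ε ρ : ℂ) * pairing m ε ρ α p ξ₀ C 0 0 x t - pairing m ε ρ α p ξ₀ C 2 0 x t)
          * brightPairing m ε ρ α p ξ₀ C k 0 x t
        + pairing m ε ρ α p ξ₀ C 1 0 x t * brightPairing m ε ρ α p ξ₀ C k 1 x t
        - pairing m ε ρ α p ξ₀ C 0 0 x t * brightPairing m ε ρ α p ξ₀ C k 2 x t) t := by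
  have h : HasDerivAt (fun y => brightPairing m ε ρ α p ξ₀ C k 0 x y) _ t :=
    HasDerivAt.fun_sum fun j _ => (hasDerivAt_resolved_snd hp h0 j).const_mul (C k j)
  refine h.congr_deriv ?_
  simp only [brightPairing, Finset.mul_sum, ← Finset.sum_sub_distrib, ← Finset.sum_add_distrib]
  exact Finset.sum_congr rfl fun j _ => by ring

theorem hasDerivAt_darkPairing_fst (hp : ∀ i j, p i + conj (p j) ≠ 0)
    (h0 : tauF m ε ρ α p ξ₀ C x t ≠ 0) (a : ℝ) (n : ℕ) :
    HasDerivAt (fun y => darkPairing m ε ρ α p ξ₀ C a n y t)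
      (darkPairing m ε ρ α p ξ₀ C a (n + 1) x t + pairing m ε ρ α p ξ₀ C 0 n x t
        - Complex.I * a * darkPairing m ε ρ α p ξ₀ C a n x t
        - pairing m ε ρ α p ξ₀ C 0 n x t * darkPairing m ε ρ α p ξ₀ C a 0 x t) x := by
  have h : HasDerivAt (fun y => darkPairing m ε ρ α p ξ₀ C a n y t) _ x :=
    HasDerivAt.fun_sum fun j _ =>
      ((hasDerivAt_conj (hasDerivAt_wave_fst j x t)).div_const (conj (p j) + Complex.I * a)).mul
        (hasDerivAt_resolved_fst hp h0 n j)
  refine h.congr_deriv ?_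
  have h1 : pairing m ε ρ α p ξ₀ C 0 n x t
      = ∑ j, conj (wave m ε ρ p ξ₀ j x t) * resolved m ε ρ α p ξ₀ C n x t j :=
    Finset.sum_congr rfl fun j _ => by ring
  -- Only the free-standing occurrence is expanded; the others stay scalar factors, so the two sides
  -- can be compared term by term in j.
  generalize pairing m ε ρ α p ξ₀ C 0 n x t = c at h1 ⊢
  nth_rewrite 2 [h1]
  simp only [darkPairing, Finset.mul_sum, ← Finset.sum_sub_distrib, ← Finset.sum_add_distrib]
  refine Finset.sum_congr rfl fun j _ => ?_
  have h8 := add_I_mul_ne_zero (hp j j) a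
  rw [map_mul]
  field_simp
  ring

/-- The last group comes from Φ_t^†: it is the division with remainder of q³ - 3Sq by q + ia, where
q = p_j^*. -/
theorem hasDerivAt_darkPairing_snd (hp : ∀ i j, p i + conj (p j) ≠ 0)
    (h0 : tauF m ε ρ α p ξ₀ C x t ≠ 0) (a : ℝ) :
    HasDerivAt (fun y => darkPairing m ε ρ α p ξ₀ C a 0 x y)
      (darkPairing m ε ρ α p ξ₀ C a 3 x t
        - 3 * (S m ε ρ : ℂ) * darkPairing m ε ρ α p ξ₀ C a 1 x t
        + (3 * (S m ε ρ : ℂ) * pairing m ε ρ α p ξ₀ C 0 0 x t - pairing m ε ρ α p ξ₀ C 2 0 x t)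
          * darkPairing m ε ρ α p ξ₀ C a 0 x t
        + pairing m ε ρ α p ξ₀ C 1 0 x t * darkPairing m ε ρ α p ξ₀ C a 1 x t
        - pairing m ε ρ α p ξ₀ C 0 0 x t * darkPairing m ε ρ α p ξ₀ C a 2 x t
        + (pairing m ε ρ α p ξ₀ C 2 0 x t - Complex.I * a * pairing m ε ρ α p ξ₀ C 1 0 x t
          - (a ^ 2 + 3 * (S m ε ρ : ℂ)) * pairing m ε ρ α p ξ₀ C 0 0 x t
          + Complex.I * (a ^ 3 + 3 * (S m ε ρ : ℂ) * a) * darkPairing m ε ρ α p ξ₀ C a 0 x t)) t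
    := by
  have h : HasDerivAt (fun y => darkPairing m ε ρ α p ξ₀ C a 0 x y) _ t :=
    HasDerivAt.fun_sum fun j _ =>
      ((hasDerivAt_conj (hasDerivAt_wave_snd j x t)).div_const (conj (p j) + Complex.I * a)).mul
        (hasDerivAt_resolved_snd hp h0 j)
  refine h.congr_deriv ?_
  have h1 : ∑ j, conj ((p j ^ 3 - 3 * (S m ε ρ : ℂ) * p j) * wave m ε ρ p ξ₀ j x t)
        / (conj (p j) + Complex.I * a) * resolved m ε ρ α p ξ₀ C 0 x t j
      = pairing m ε ρ α p ξ₀ C 2 0 x t - Complex.I * a * pairing m ε ρ α p ξ₀ C 1 0 x t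
          - (a ^ 2 + 3 * (S m ε ρ : ℂ)) * pairing m ε ρ α p ξ₀ C 0 0 x t
          + Complex.I * (a ^ 3 + 3 * (S m ε ρ : ℂ) * a) * darkPairing m ε ρ α p ξ₀ C a 0 x t := by
    simp only [pairing, darkPairing, Finset.mul_sum, ← Finset.sum_sub_distrib,
      ← Finset.sum_add_distrib]
    refine Finset.sum_congr rfl fun j _ => ?_
    have h8 := add_I_mul_ne_zero (hp j j) a
    simp only [map_mul, map_sub, map_pow, Complex.conj_ofReal, map_ofNat]
    field_simp
    linear_combination conj (p j) * conj (wave m ε ρ p ξ₀ j x t)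
      * resolved m ε ρ α p ξ₀ C 0 x t j * (a : ℂ) ^ 2 * Complex.I_sq
  rw [Finset.sum_add_distrib, h1, add_comm]
  congr 1
  simp only [darkPairing, Finset.mul_sum, ← Finset.sum_sub_distrib, ← Finset.sum_add_distrib]
  exact Finset.sum_congr rfl fun j _ => by ring

end Soliton

theorem dx_succ_eq {F G : ℝ → ℝ → ℂ} {Ω : Set (ℝ × ℝ)} (hΩ : IsOpen Ω) {n : ℕ}
    (hF : ∀ x t, (x, t) ∈ Ω → dx n F x t = G x t) {x t : ℝ} (h : (x, t) ∈ Ω) {G' : ℂ}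
    (hG : HasDerivAt (fun y => G y t) G' x) : dx (n + 1) F x t = G' := by
  rw [dx, iteratedDeriv_succ, ← hG.deriv]
  apply Filter.EventuallyEq.deriv_eq
  filter_upwards [eventually_fst hΩ h] with y hy using hF y t hy

section Soliton

variable {M N : ℕ} {m : ℕ} {ε ρ α : Fin M → ℝ} {p ξ₀ : Fin N → ℂ} {C : Fin M → Fin N → ℂ}
  {x t : ℝ}

/-! ### Smoothness -/

theorem contDiff_wave (n : ℕ) (i : Fin N) :
    ContDiff ℝ n fun q : ℝ × ℝ => wave m ε ρ p ξ₀ i q.1 q.2 := by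
  have h1 : ContDiff ℝ n fun q : ℝ × ℝ => (q.1 : ℂ) := Complex.ofRealCLM.contDiff.comp contDiff_fst
  have h2 : ContDiff ℝ n fun q : ℝ × ℝ => (q.2 : ℂ) := Complex.ofRealCLM.contDiff.comp contDiff_snd
  exact (((contDiff_const.mul (h1.sub (contDiff_const.mul h2))).add
    (contDiff_const.mul h2)).add contDiff_const).cexp

theorem contDiff_conj_wave (n : ℕ) (i : Fin N) :
    ContDiff ℝ n fun q : ℝ × ℝ => conj (wave m ε ρ p ξ₀ i q.1 q.2) :=
  Complex.conjCLE.contDiff.comp (contDiff_wave n i)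

theorem contDiff_mat_zero (n : ℕ) (i j : Fin N) :
    ContDiff ℝ n fun q : ℝ × ℝ => mat m ε ρ α p ξ₀ C 0 q.1 q.2 i j := by
  simp only [mat_zero_apply, div_eq_mul_inv]
  exact (((contDiff_wave n i).mul (contDiff_conj_wave n j)).add contDiff_const).mul contDiff_const

theorem contDiff_tauF (n : ℕ) :
    ContDiff ℝ n fun q : ℝ × ℝ => tauF m ε ρ α p ξ₀ C q.1 q.2 :=
  contDiff_det (contDiff_mat_zero n)

theorem contDiff_tauG (n : ℕ) (k : Fin M) :
    ContDiff ℝ n fun q : ℝ × ℝ => tauG m ε ρ α p ξ₀ C k q.1 q.2 := by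
  refine contDiff_det fun i j => ?_
  rcases i with i | i <;> rcases j with j | j
  · exact contDiff_mat_zero n i j
  · exact contDiff_wave n i
  · exact contDiff_const
  · exact contDiff_const

theorem contDiff_tauH (hp : ∀ i j, p i + conj (p j) ≠ 0) (n : ℕ) {l : Fin M}
    (hl : l ∈ dark M m) : ContDiff ℝ n fun q : ℝ × ℝ => tauH m ε ρ α p ξ₀ C l q.1 q.2 := by
  refine contDiff_det fun i j => ?_
  simp only [mat_single_apply hp hl, div_eq_mul_inv]
  exact (contDiff_mat_zero n i j).sub
    ((contDiff_wave n i).mul ((contDiff_conj_wave n j).mul contDiff_const))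

variable (m ε ρ α p ξ₀ C) in
/-- The set where the solitons are regular. -/
def regularSet : Set (ℝ × ℝ) := {q | tauF m ε ρ α p ξ₀ C q.1 q.2 ≠ 0}

theorem isOpen_regularSet : IsOpen (regularSet m ε ρ α p ξ₀ C) :=
  isOpen_ne_fun (contDiff_tauF 0).continuous continuous_const

theorem admissibleOn_tau (hp : ∀ i j, p i + conj (p j) ≠ 0) :
    AdmissibleOn m (regularSet m ε ρ α p ξ₀ C) (tauF m ε ρ α p ξ₀ C) (tauG m ε ρ α p ξ₀ C)
      (tauH m ε ρ α p ξ₀ C) where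
  isOpen := isOpen_regularSet
  smooth_f := (contDiff_tauF 3).contDiffOn
  smooth_g k _ := (contDiff_tauG 3 k).contDiffOn
  smooth_h _ hl := (contDiff_tauH hp 3 hl).contDiffOn
  real_f x t _ := conj_tauF x t
  ne_zero_f _ _ h := h

/-! ### The envelopes of the solitons -/

/-- Schur complement of the bordered determinant with respect to M_0. -/
theorem tauG_eq (h0 : tauF m ε ρ α p ξ₀ C x t ≠ 0) (k : Fin M) :
    tauG m ε ρ α p ξ₀ C k x t
      = tauF m ε ρ α p ξ₀ C x t * brightPairing m ε ρ α p ξ₀ C k 0 x t := by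
  let _ : Invertible (mat m ε ρ α p ξ₀ C 0 x t) :=
    Matrix.invertibleOfIsUnitDet _ (Ne.isUnit h0)
  rw [tauG, Matrix.det_fromBlocks₁₁, tauF, Matrix.det_unique (n := Unit), zero_sub,
    Matrix.invOf_eq_nonsing_inv, Matrix.mul_assoc]
  congr 1
  simp only [Matrix.neg_apply, Matrix.mul_apply, Matrix.of_apply, brightPairing, resolved,
    Matrix.mulVec, dotProduct, pow_zero, one_mul, neg_mul, Finset.sum_neg_distrib, neg_neg]
  rfl

/-- Matrix determinant lemma for the rank-one perturbation in `mat_single_apply`. -/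
theorem tauH_eq (hp : ∀ i j, p i + conj (p j) ≠ 0) (h0 : tauF m ε ρ α p ξ₀ C x t ≠ 0)
    {l : Fin M} (hl : l ∈ dark M m) :
    tauH m ε ρ α p ξ₀ C l x t
      = tauF m ε ρ α p ξ₀ C x t * (1 - darkPairing m ε ρ α p ξ₀ C (α l) 0 x t) := by
  have h1 : mat m ε ρ α p ξ₀ C (Pi.single l 1) x t = mat m ε ρ α p ξ₀ C 0 x t
      + Matrix.replicateCol Unit (fun i => wave m ε ρ p ξ₀ i x t)
        * Matrix.replicateRow Unit (fun j => -(conj (wave m ε ρ p ξ₀ j x t)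
          / (conj (p j) + Complex.I * (α l : ℂ)))) := by
    ext i j
    rw [mat_single_apply hp hl, Matrix.add_apply, Matrix.mul_apply, Finset.univ_unique,
      Finset.sum_singleton, Matrix.replicateCol_apply, Matrix.replicateRow_apply]
    ring
  rw [tauH, h1, Matrix.det_add_replicateCol_mul_replicateRow (Ne.isUnit h0), tauF,
    Matrix.det_unique (n := Unit), Matrix.add_apply, Matrix.one_apply_eq, Matrix.mul_assoc]
  congr 1
  simp only [Matrix.mul_apply, darkPairing, resolved, Matrix.replicateCol_apply,
    Matrix.replicateRow_apply,
    Matrix.mulVec, dotProduct, pow_zero, one_mul, neg_mul, Finset.sum_neg_distrib, sub_eq_add_neg]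

theorem envelope_bright (h0 : tauF m ε ρ α p ξ₀ C x t ≠ 0) {k : Fin M} (hk : k ∈ bright M m) :
    envelope m (tauF m ε ρ α p ξ₀ C) (tauG m ε ρ α p ξ₀ C) (tauH m ε ρ α p ξ₀ C) k x t
      = brightPairing m ε ρ α p ξ₀ C k 0 x t := by
  rw [envelope, if_pos (mem_bright.1 hk), tauG_eq h0, mul_div_cancel_left₀ _ h0]

theorem envelope_dark (hp : ∀ i j, p i + conj (p j) ≠ 0) (h0 : tauF m ε ρ α p ξ₀ C x t ≠ 0)
    {l : Fin M} (hl : l ∈ dark M m) :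
    envelope m (tauF m ε ρ α p ξ₀ C) (tauG m ε ρ α p ξ₀ C) (tauH m ε ρ α p ξ₀ C) l x t
      = 1 - darkPairing m ε ρ α p ξ₀ C (α l) 0 x t := by
  rw [envelope, if_neg (mem_dark.1 hl), tauH_eq hp h0 hl, mul_div_cancel_left₀ _ h0]

/-- Any function built from the solution of the linear system in the way common to bright and dark
components solves the linear problem with the potentials of the solitons. -/
theorem linear_problem (hp : ∀ i j, p i + conj (p j) ≠ 0) (κ a : ℂ) (b : ℕ → ℝ → ℝ → ℂ)
    (hbx : ∀ n x t, (x, t) ∈ regularSet m ε ρ α p ξ₀ C → HasDerivAt (fun y => b n y t)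
      (b (n + 1) x t + κ * pairing m ε ρ α p ξ₀ C 0 n x t - Complex.I * a * b n x t
        - pairing m ε ρ α p ξ₀ C 0 n x t * b 0 x t) x)
    (hbt : ∀ x t, (x, t) ∈ regularSet m ε ρ α p ξ₀ C → HasDerivAt (fun y => b 0 x y)
      (b 3 x t - 3 * (S m ε ρ : ℂ) * b 1 x t
        + (3 * (S m ε ρ : ℂ) * pairing m ε ρ α p ξ₀ C 0 0 x t - pairing m ε ρ α p ξ₀ C 2 0 x t)
          * b 0 x t
        + pairing m ε ρ α p ξ₀ C 1 0 x t * b 1 x t - pairing m ε ρ α p ξ₀ C 0 0 x t * b 2 x t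
        + (κ * (pairing m ε ρ α p ξ₀ C 2 0 x t - Complex.I * a * pairing m ε ρ α p ξ₀ C 1 0 x t
          - (a ^ 2 + 3 * (S m ε ρ : ℂ)) * pairing m ε ρ α p ξ₀ C 0 0 x t)
          + Complex.I * (a ^ 3 + 3 * (S m ε ρ : ℂ) * a) * b 0 x t)) t)
    (w : ℝ → ℝ → ℂ) (hw : ∀ x t, (x, t) ∈ regularSet m ε ρ α p ξ₀ C → w x t = κ - b 0 x t)
    (h : (x, t) ∈ regularSet m ε ρ α p ξ₀ C) :
    dx 1 w x t = -(b 1 x t + κ * pairing m ε ρ α p ξ₀ C 0 0 x t - Complex.I * a * b 0 x t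
        - pairing m ε ρ α p ξ₀ C 0 0 x t * b 0 x t) ∧
    dt w x t - Complex.I * (a ^ 3 + 3 * A m ε ρ α + 3 * a * S m ε ρ) * w x t
      = dx 3 w x t + 3 * Complex.I * a * dx 2 w x t - 3 * a ^ 2 * dx 1 w x t
        - Complex.I * a ^ 3 * w x t
        - 3 * (S m ε ρ - curvature m ε ρ α p ξ₀ C x t) * (dx 1 w x t + Complex.I * a * w x t)
        - 3 * w x t * (Complex.I * A m ε ρ α - torsion m ε ρ α p ξ₀ C x t) := by
  have hΩ := isOpen_regularSet (m := m) (ε := ε) (ρ := ρ) (α := α) (p := p) (ξ₀ := ξ₀) (C := C)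
  have hc : ∀ a n x t, (x, t) ∈ regularSet m ε ρ α p ξ₀ C →
      HasDerivAt (fun y => pairing m ε ρ α p ξ₀ C a n y t)
        (pairing m ε ρ α p ξ₀ C (a + 1) n x t + pairing m ε ρ α p ξ₀ C a (n + 1) x t
          - pairing m ε ρ α p ξ₀ C 0 n x t * pairing m ε ρ α p ξ₀ C a 0 x t) x :=
    fun a n x t h => hasDerivAt_pairing_fst hp h a n
  have d0 : ∀ x t, (x, t) ∈ regularSet m ε ρ α p ξ₀ C → dx 0 w x t = κ - b 0 x t :=
    fun x t h => by rw [dx_zero, hw x t h]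
  have d1 := fun x t (h : (x, t) ∈ regularSet m ε ρ α p ξ₀ C) =>
    dx_succ_eq hΩ d0 h ((hbx 0 x t h).const_sub κ)
  have e1 := fun x t (h : (x, t) ∈ regularSet m ε ρ α p ξ₀ C) =>
    ((((hbx 1 x t h).add ((hc 0 0 x t h).const_mul κ)).sub
      ((hbx 0 x t h).const_mul (Complex.I * a))).sub ((hc 0 0 x t h).mul (hbx 0 x t h))).neg
  have d2 := fun x t (h : (x, t) ∈ regularSet m ε ρ α p ξ₀ C) => dx_succ_eq hΩ d1 h (e1 x t h)
  have q0 := hbx 0 x t h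
  have q1 := hbx 1 x t h
  have q2 := hbx 2 x t h
  have c00 := hc 0 0 x t h
  have c01 := hc 0 1 x t h
  have c10 := hc 1 0 x t h
  -- The third derivative, assembled in the grouping in which `e1` produced the second one, so that
  -- the function differentiated agrees definitionally with it.
  have e2 := ((((q2.add (c01.const_mul κ)).sub (q1.const_mul (Complex.I * a))).sub (c01.mul q0)).add
    (((c10.add c01).sub (c00.mul c00)).const_mul κ)).sub
    ((((q1.add (c00.const_mul κ)).sub (q0.const_mul (Complex.I * a))).sub (c00.mul q0)).const_mul
      (Complex.I * a)) |>.sub ((((c10.add c01).sub (c00.mul c00)).mul q0).add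
      (c00.mul (((q1.add (c00.const_mul κ)).sub (q0.const_mul (Complex.I * a))).sub (c00.mul q0))))
      |>.neg
  have d3 := dx_succ_eq hΩ (fun x t h => (d2 x t h).trans (by
    simp only [zero_add]; rfl)) h e2
  have dt0 : dt w x t = _ := (dt_congr hΩ h hw).trans ((hbt x t h).const_sub κ).deriv
  refine ⟨d1 x t h, ?_⟩
  rw [dt0, hw x t h, d1 x t h, d2 x t h, d3, torsion, curvature]
  simp only [Pi.add_apply, Pi.sub_apply, Pi.mul_apply, zero_add, Nat.reduceAdd]
  ring_nf
  simp only [Complex.I_sq, Complex.I_pow_three]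
  ring

end Soliton

/-! ### From the linear problem to the nonlinear equation: potentials as density and current -/

section Soliton

variable {M N : ℕ} {m : ℕ} {ε ρ α : Fin M → ℝ} {p ξ₀ : Fin N → ℂ} {C : Fin M → Fin N → ℂ}
  {x t : ℝ}

/-- The case κ = 0, a = 0 of `linear_problem`; the pairings enter with a minus sign because the
envelope there is κ - b. -/
theorem bright_linear_problem (hp : ∀ i j, p i + conj (p j) ≠ 0) {k : Fin M}
    (hk : k ∈ bright M m) {w : ℝ → ℝ → ℂ}
    (hw : w = envelope m (tauF m ε ρ α p ξ₀ C) (tauG m ε ρ α p ξ₀ C) (tauH m ε ρ α p ξ₀ C) k)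
    (h : (x, t) ∈ regularSet m ε ρ α p ξ₀ C) :
    dx 1 w x t = brightPairing m ε ρ α p ξ₀ C k 1 x t
        - pairing m ε ρ α p ξ₀ C 0 0 x t * brightPairing m ε ρ α p ξ₀ C k 0 x t ∧
    dt w x t - Complex.I * (3 * A m ε ρ α) * w x t
      = dx 3 w x t - 3 * (S m ε ρ - curvature m ε ρ α p ξ₀ C x t) * dx 1 w x t
        - 3 * w x t * (Complex.I * A m ε ρ α - torsion m ε ρ α p ξ₀ C x t) := by
  obtain ⟨h1, h2⟩ := linear_problem (m := m) (ε := ε) (ρ := ρ) (α := α) (ξ₀ := ξ₀) (C := C) hp 0 0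
    (fun n x t => -brightPairing m ε ρ α p ξ₀ C k n x t)
    (fun n x t h => (hasDerivAt_brightPairing_fst hp h k n).fun_neg.congr_deriv (by ring))
    (fun x t h => (hasDerivAt_brightPairing_snd hp h k).fun_neg.congr_deriv (by ring)) w
    (fun x t h => by rw [hw, envelope_bright h hk]; ring) h
  constructor
  · rw [h1]
    ring
  · linear_combination h2

theorem dark_linear_problem (hp : ∀ i j, p i + conj (p j) ≠ 0) {l : Fin M}
    (hl : l ∈ dark M m) {w : ℝ → ℝ → ℂ}
    (hw : w = envelope m (tauF m ε ρ α p ξ₀ C) (tauG m ε ρ α p ξ₀ C) (tauH m ε ρ α p ξ₀ C) l)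
    (h : (x, t) ∈ regularSet m ε ρ α p ξ₀ C) :
    dx 1 w x t = -(darkPairing m ε ρ α p ξ₀ C (α l) 1 x t + pairing m ε ρ α p ξ₀ C 0 0 x t
        - Complex.I * α l * darkPairing m ε ρ α p ξ₀ C (α l) 0 x t
        - pairing m ε ρ α p ξ₀ C 0 0 x t * darkPairing m ε ρ α p ξ₀ C (α l) 0 x t) ∧
    dt w x t - Complex.I * (α l ^ 3 + 3 * A m ε ρ α + 3 * α l * S m ε ρ) * w x t
      = dx 3 w x t + 3 * Complex.I * α l * dx 2 w x t - 3 * α l ^ 2 * dx 1 w x t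
        - Complex.I * α l ^ 3 * w x t
        - 3 * (S m ε ρ - curvature m ε ρ α p ξ₀ C x t) * (dx 1 w x t + Complex.I * α l * w x t)
        - 3 * w x t * (Complex.I * A m ε ρ α - torsion m ε ρ α p ξ₀ C x t) := by
  obtain ⟨h1, h2⟩ := linear_problem (m := m) (ε := ε) (ρ := ρ) (α := α) (ξ₀ := ξ₀) (C := C) hp 1
    (α l) (darkPairing m ε ρ α p ξ₀ C (α l))
    (fun n x t h => (hasDerivAt_darkPairing_fst hp h (α l) n).congr_deriv (by ring))
    (fun x t h => (hasDerivAt_darkPairing_snd hp h (α l)).congr_deriv (by ring)) w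
    (fun x t h => by rw [hw, envelope_dark hp h hl]) h
  refine ⟨?_, h2⟩
  rw [h1]
  ring

/-- For each dark l, with d its pairing, |1 - d|² + (d + d^* - d^*d) = 1. The dark part of
`sum_bright_pairing` at n = 0 thus completes the dark densities to S, leaving only the curvature. -/
theorem density_tau (hp : ∀ i j, p i + conj (p j) ≠ 0) (hG : ∀ i j, gram m ε ρ α p i j ≠ 0)
    (h : (x, t) ∈ regularSet m ε ρ α p ξ₀ C) :
    density m ε ρ (envelope m (tauF m ε ρ α p ξ₀ C) (tauG m ε ρ α p ξ₀ C)
      (tauH m ε ρ α p ξ₀ C)) x t = S m ε ρ - curvature m ε ρ α p ξ₀ C x t := by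
  have hb := sum_bright_pairing hp hG h 0
  rw [density, ← sum_bright_add_sum_dark (m := m)]
  have h1 : ∀ k ∈ bright M m, (ε k : ℂ) * (amplitude m ρ k : ℂ) ^ 2 *
      (conj (envelope m (tauF m ε ρ α p ξ₀ C) (tauG m ε ρ α p ξ₀ C) (tauH m ε ρ α p ξ₀ C) k x t) *
        envelope m (tauF m ε ρ α p ξ₀ C) (tauG m ε ρ α p ξ₀ C) (tauH m ε ρ α p ξ₀ C) k x t)
      = (ε k : ℂ) * (conj (brightPairing m ε ρ α p ξ₀ C k 0 x t)
        * brightPairing m ε ρ α p ξ₀ C k 0 x t) := fun k hk => by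
    rw [envelope_bright h hk, amplitude_bright hk, Complex.ofReal_one, one_pow, mul_one]
  rw [Finset.sum_congr rfl h1, hb, sub_add_eq_add_sub, ← Finset.sum_add_distrib, curvature, S]
  push_cast
  have h2 : ∀ l ∈ dark M m, (ε l : ℂ) * (ρ l : ℂ) ^ 2 *
        (darkPairing m ε ρ α p ξ₀ C (α l) 0 x t + adjointPairing m ε ρ α p ξ₀ C (α l) 0 x t
        - adjointPairing m ε ρ α p ξ₀ C (α l) 0 x t * darkPairing m ε ρ α p ξ₀ C (α l) 0 x t)
      + (ε l : ℂ) * (amplitude m ρ l : ℂ) ^ 2 *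
      (conj (envelope m (tauF m ε ρ α p ξ₀ C) (tauG m ε ρ α p ξ₀ C) (tauH m ε ρ α p ξ₀ C) l x t) *
        envelope m (tauF m ε ρ α p ξ₀ C) (tauG m ε ρ α p ξ₀ C) (tauH m ε ρ α p ξ₀ C) l x t)
      = (ε l : ℂ) * (ρ l : ℂ) ^ 2 := fun l hl => by
    rw [envelope_dark hp h hl, amplitude_dark hl, map_sub, conj_darkPairing, map_one]
    ring
  rw [Finset.sum_congr rfl h2]
  ring

/-- The bright current is the case n = 1 of `sum_bright_pairing` minus Φ^† z_0 times the case n = 0.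
Combined with the dark current, everything cancels for each l except iα_l, which sums to iA. -/
theorem current_tau (hp : ∀ i j, p i + conj (p j) ≠ 0) (hG : ∀ i j, gram m ε ρ α p i j ≠ 0)
    (h : (x, t) ∈ regularSet m ε ρ α p ξ₀ C) :
    current m ε ρ α (envelope m (tauF m ε ρ α p ξ₀ C) (tauG m ε ρ α p ξ₀ C)
      (tauH m ε ρ α p ξ₀ C)) x t = Complex.I * A m ε ρ α - torsion m ε ρ α p ξ₀ C x t := by
  have hb0 := sum_bright_pairing hp hG h 0
  have hb1 := sum_bright_pairing hp hG h 1
  set w := envelope m (tauF m ε ρ α p ξ₀ C) (tauG m ε ρ α p ξ₀ C) (tauH m ε ρ α p ξ₀ C) with hw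
  rw [current, ← sum_bright_add_sum_dark (m := m)]
  have h1 : ∑ k ∈ bright M m, (ε k : ℂ) * (amplitude m ρ k : ℂ) ^ 2 *
      (conj (w k x t) * (dx 1 (w k) x t + Complex.I * (waveNumber m α k : ℂ) * w k x t))
      = ∑ k ∈ bright M m, (ε k : ℂ) * (conj (brightPairing m ε ρ α p ξ₀ C k 0 x t)
          * brightPairing m ε ρ α p ξ₀ C k 1 x t)
        - pairing m ε ρ α p ξ₀ C 0 0 x t * ∑ k ∈ bright M m, (ε k : ℂ) *
          (conj (brightPairing m ε ρ α p ξ₀ C k 0 x t)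
          * brightPairing m ε ρ α p ξ₀ C k 0 x t) := by
    rw [Finset.mul_sum, ← Finset.sum_sub_distrib]
    refine Finset.sum_congr rfl fun k hk => ?_
    rw [(bright_linear_problem hp hk (congrFun hw k) h).1, hw, envelope_bright h hk,
      amplitude_bright hk, waveNumber_bright hk]
    push_cast
    ring
  have h2 : ∑ l ∈ dark M m, (ε l : ℂ) * (amplitude m ρ l : ℂ) ^ 2 *
      (conj (w l x t) * (dx 1 (w l) x t + Complex.I * (waveNumber m α l : ℂ) * w l x t))
      + ∑ l ∈ dark M m, (ε l : ℂ) * (ρ l : ℂ) ^ 2 *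
        (darkPairing m ε ρ α p ξ₀ C (α l) 1 x t + adjointPairing m ε ρ α p ξ₀ C (α l) 1 x t
        - adjointPairing m ε ρ α p ξ₀ C (α l) 0 x t * darkPairing m ε ρ α p ξ₀ C (α l) 1 x t)
      - pairing m ε ρ α p ξ₀ C 0 0 x t * ∑ l ∈ dark M m, (ε l : ℂ) * (ρ l : ℂ) ^ 2 *
        (darkPairing m ε ρ α p ξ₀ C (α l) 0 x t + adjointPairing m ε ρ α p ξ₀ C (α l) 0 x t
        - adjointPairing m ε ρ α p ξ₀ C (α l) 0 x t * darkPairing m ε ρ α p ξ₀ C (α l) 0 x t)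
      = Complex.I * A m ε ρ α := by
    rw [A, Finset.mul_sum, ← Finset.sum_add_distrib, ← Finset.sum_sub_distrib, Complex.ofReal_sum,
      Finset.mul_sum]
    refine Finset.sum_congr rfl fun l hl => ?_
    rw [(dark_linear_problem hp hl (congrFun hw l) h).1, hw, envelope_dark hp h hl,
      amplitude_dark hl, waveNumber_dark hl, map_sub, conj_darkPairing, map_one,
      adjointPairing_one hp h]
    push_cast
    ring
  rw [h1, hb0, hb1, ← h2, torsion, curvature]
  ring

theorem envelopeEq_tau (hp : ∀ i j, p i + conj (p j) ≠ 0) (hG : ∀ i j, gram m ε ρ α p i j ≠ 0)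
    (h : (x, t) ∈ regularSet m ε ρ α p ξ₀ C) (k : Fin M) :
    EnvelopeEq m ε ρ α (envelope m (tauF m ε ρ α p ξ₀ C) (tauG m ε ρ α p ξ₀ C)
      (tauH m ε ρ α p ξ₀ C)) k x t := by
  rw [EnvelopeEq, density_tau hp hG h, current_tau hp hG h, frequency]
  by_cases hk : k.val < m
  · have h1 := (bright_linear_problem hp (mem_bright.2 hk) rfl h).2
    rw [waveNumber_bright (mem_bright.2 hk)]
    push_cast
    linear_combination h1
  · have h1 := (dark_linear_problem hp (mem_dark.2 hk) rfl h).2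
    rw [waveNumber_dark (mem_dark.2 hk)]
    push_cast
    linear_combination h1

/-- D_x^2 f·f = 2 f² (log f)_xx. -/
theorem Dx_two_tauF (hp : ∀ i j, p i + conj (p j) ≠ 0)
    (h : (x, t) ∈ regularSet m ε ρ α p ξ₀ C) :
    Dx 2 (tauF m ε ρ α p ξ₀ C) (tauF m ε ρ α p ξ₀ C) x t
      = 2 * tauF m ε ρ α p ξ₀ C x t ^ 2 * curvature m ε ρ α p ξ₀ C x t := by
  have hΩ := isOpen_regularSet (m := m) (ε := ε) (ρ := ρ) (α := α) (p := p) (ξ₀ := ξ₀) (C := C)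
  have d1 : ∀ x t, (x, t) ∈ regularSet m ε ρ α p ξ₀ C → dx 1 (tauF m ε ρ α p ξ₀ C) x t
      = tauF m ε ρ α p ξ₀ C x t * pairing m ε ρ α p ξ₀ C 0 0 x t :=
    fun x t h => dx_succ_eq hΩ (fun _ _ _ => dx_zero) h (hasDerivAt_tauF hp h)
  have d2 := dx_succ_eq hΩ d1 h ((hasDerivAt_tauF hp h).mul (hasDerivAt_pairing_fst hp h 0 0))
  norm_num at d2
  simp only [Dx, Finset.sum_range_succ, Finset.sum_range_zero, Nat.choose]
  norm_num
  rw [d1 x t h, d2, curvature]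
  ring

/-- The rank-one perturbation sees l only through α_l, so equal wave numbers give equal h, and hence
the zero Wronskian that (6) then demands. -/
theorem tauH_congr (hp : ∀ i j, p i + conj (p j) ≠ 0)
    {l i : Fin M} (hl : l ∈ dark M m) (hi : i ∈ dark M m) (hα : α l = α i) :
    tauH m ε ρ α p ξ₀ C l = tauH m ε ρ α p ξ₀ C i := by
  ext x t
  rw [tauH, tauH]
  congr 1
  ext a b
  rw [mat_single_apply hp hl, mat_single_apply hp hi, hα]

end Soliton

/-! ### Existence of the auxiliary functions -/

section Auxiliary

variable {M : ℕ} {m : ℕ} {ε ρ α : Fin M → ℝ} {Ω : Set (ℝ × ℝ)} {f : ℝ → ℝ → ℂ}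
  {g h : Fin M → ℝ → ℝ → ℂ}

/-- For nonzero wave numbers the auxiliary functions exist as soon as the quadratic relation holds
and components with equal wave numbers have a vanishing Wronskian. -/
theorem exists_auxiliaryOn (had : AdmissibleOn m Ω f g h) (hα : ∀ l ∈ dark M m, α l ≠ 0)
    (hquad : ∀ x t, (x, t) ∈ Ω → Dx 2 f f x t
      = 2 * f x t ^ 2 * ((S m ε ρ : ℂ) - density m ε ρ (envelope m f g h) x t))
    (hdeg : ∀ l ∈ dark M m, ∀ i ∈ dark M m, α l = α i → ∀ x t, (x, t) ∈ Ω →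
      Dx 1 (h l) (h i) x t = 0) :
    ∃ s r : Fin M → Fin M → ℝ → ℝ → ℂ, AuxiliaryOn m ε ρ α Ω f g h s r := by
  have hanti : ∀ (F G : ℝ → ℝ → ℂ) x t, Dx 1 F G x t = -Dx 1 G F x t := by
    intro F G x t
    simp only [Dx, Finset.sum_range_succ, Finset.sum_range_zero, Nat.choose]
    norm_num
    ring
  let R : Fin M → Fin M → ℝ → ℝ → ℂ := fun k i x t =>
    (Dx 1 (g k) (h i) x t - Complex.I * (α i : ℂ) * (g k x t * h i x t))
      / (-Complex.I * (α i : ℂ) * f x t)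
  -- Each function is obtained by solving its defining relation. The case split on bright indices
  -- makes r symmetric; for equal dark wave numbers division by zero gives r = 0, a harmless choice
  -- because (6) then reads 0 = 0.
  refine ⟨fun k i x t => Dx 1 (g k) (g i) x t / f x t, fun k i x t =>
    if k.val < m then R k i x t else if i.val < m then R i k x t else
      (Dx 1 (h k) (h i) x t + Complex.I * ((α k : ℂ) - (α i : ℂ)) * (h k x t * h i x t))
      / (Complex.I * ((α k : ℂ) - (α i : ℂ)) * f x t), ?_, ?_, ?_, ?_, ?_, ?_⟩
  · exact fun x t hxt => (quadratic_iff had hxt).2 (hquad x t hxt)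
  · intro k _ i _ x t hxt
    rw [div_mul_cancel₀ _ (had.ne_zero_f x t hxt)]
  · intro k hk i hi x t hxt
    have h1 : (α i : ℂ) ≠ 0 := Complex.ofReal_ne_zero.2 (hα i hi)
    have h2 := had.ne_zero_f x t hxt
    have h3 := Complex.I_ne_zero
    simp only [if_pos (mem_bright.1 hk), R]
    field_simp
  · intro l hl i hi x t hxt
    have h2 := had.ne_zero_f x t hxt
    have h3 := Complex.I_ne_zero
    simp only [if_neg (mem_dark.1 hl), if_neg (mem_dark.1 hi)]
    by_cases he : α l = α i
    · rw [he, hdeg l hl i hi he x t hxt]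
      ring
    · have h1 : (α l : ℂ) - (α i : ℂ) ≠ 0 :=
        sub_ne_zero.2 fun h => he (Complex.ofReal_injective h)
      field_simp
  · intro k _ i _ x t _
    rw [hanti, neg_div]
  · intro l hl i x t _
    simp only [if_neg (mem_dark.1 hl)]
    by_cases hi : i.val < m
    · simp only [hi, if_true]
    · simp only [hi, if_false]
      rw [hanti, ← neg_div_neg_eq]
      congr 1 <;> ring

end Auxiliary

end VectorHirota

/-! ### The theorem -/

theorem theoremA3 {M : ℕ} (m : ℕ) (hm : 0 < m) (hmM : m < M) (ε ρ α : Fin M → ℝ) :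
    (∀ (Ω : Set (ℝ × ℝ)) (f : ℝ → ℝ → ℂ) (g h : Fin M → ℝ → ℝ → ℂ)
        (s r : Fin M → Fin M → ℝ → ℝ → ℂ),
      VectorHirota.AdmissibleOn m Ω f g h →
      VectorHirota.AuxiliaryOn m ε ρ α Ω f g h s r →
        (VectorHirota.EvolutionOn m ε ρ α Ω f g h s r →
          VectorHirota.IsSolutionOn ε Ω (VectorHirota.field m ε ρ α f g h)) ∧
        ((∀ l ∈ VectorHirota.dark M m, ρ l ≠ 0) →
          VectorHirota.IsSolutionOn ε Ω (VectorHirota.field m ε ρ α f g h) →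
          VectorHirota.EvolutionOn m ε ρ α Ω f g h s r)) ∧
    (∀ (N : ℕ) (p ξ₀ : Fin N → ℂ) (C : Fin M → Fin N → ℂ),
      (∀ i j, p i + conj (p j) ≠ 0) →
      (∀ i j, VectorHirota.gram m ε ρ α p i j ≠ 0) →
      ∀ (f : ℝ → ℝ → ℂ) (g h : Fin M → ℝ → ℝ → ℂ) (Ω : Set (ℝ × ℝ)),
      f = VectorHirota.tauF m ε ρ α p ξ₀ C →
      g = VectorHirota.tauG m ε ρ α p ξ₀ C →
      h = VectorHirota.tauH m ε ρ α p ξ₀ C →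
      Ω = {q : ℝ × ℝ | f q.1 q.2 ≠ 0} →
        VectorHirota.AdmissibleOn m Ω f g h ∧
        VectorHirota.IsSolutionOn ε Ω (VectorHirota.field m ε ρ α f g h) ∧
        ((∀ l ∈ VectorHirota.dark M m, α l ≠ 0) →
          ∃ s r : Fin M → Fin M → ℝ → ℝ → ℂ,
            VectorHirota.AuxiliaryOn m ε ρ α Ω f g h s r ∧
            VectorHirota.EvolutionOn m ε ρ α Ω f g h s r)) := by
  refine ⟨fun Ω f g h s r had haux => VectorHirota.bilinearization had haux, ?_⟩
  rintro N p ξ₀ C hp hG f g h Ω rfl rfl rfl rfl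
  have had := VectorHirota.admissibleOn_tau (m := m) (ε := ε) (ρ := ρ) (α := α) (ξ₀ := ξ₀)
    (C := C) hp
  -- (H) is read off the envelope equations directly, not from the bilinear system: for α_i = 0
  -- relation (5) would force D_x g_k·h_i = 0.
  refine ⟨had, had.isSolutionOn_iff.2 fun k x t hxt =>
    Or.inr (VectorHirota.envelopeEq_tau hp hG hxt k), fun hα => ?_⟩
  obtain ⟨s, r, haux⟩ := VectorHirota.exists_auxiliaryOn (ε := ε) (ρ := ρ) had hα
    (fun x t hxt => by
      rw [VectorHirota.Dx_two_tauF hp hxt, VectorHirota.density_tau hp hG hxt, sub_sub_cancel])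
    (fun l hl i hi he x t _ => by
      rw [VectorHirota.tauH_congr hp hl hi he]
      simp only [VectorHirota.Dx, Finset.sum_range_succ, Finset.sum_range_zero, Nat.choose]
      norm_num
      ring)
  -- The envelope equations hold even where ρ_l = 0, so (1) and (2) follow without the nonvanishing
  -- needed in (a).
  exact ⟨s, r, haux, (VectorHirota.evolutionOn_iff had haux).2 fun k x t hxt =>
    VectorHirota.envelopeEq_tau hp hG hxt k⟩
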